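/- Let $q$ be a prime power, $A=\mathbb F_q[T]$, $K=\mathbb F_q(T)$, and let $L$ be any field extension of $K$ (for example $\mathbb C_\infty$). A Drinfeld module of rank 2 over an $A$-field $F$ is an $\mathbb F_q$-linear ring homomorphism $\phi:A\to F\{\tau\}$, $a\mapsto\phi_a$, with $\phi_T=T+g\tau+\Delta\tau^2$ and $\Delta\ne0$, where $\tau$ is $z\mapsto z^q$. Let $e_\phi(z)=z+\cdots$ be the $\mathbb F_q$-linear power series (for $\phi$ over $L$) with $e_\phi(Tz)=\phi_T(e_\phi(z))$, let $\log_\phi(z)=\sum_{j\ge0}\beta_jz^{q^j}$ be its formal inverse, and for $n\ge 0$ put $$\mathfrak a_n=T\sum_{j=0}^n\beta_j,\qquad L_n=\prod_{i=1}^n(T^{q^i}-T),\qquad b_n=\frac{L_n\,\mathfrak a_n}{T^{1+q+\cdots+q^n}}.$$ The Bassa–Beelen polynomials $p_n(x)\in K[x]$ are given by $p_{-1}=0$, $p_0=1$ and $$p_{n+1}(x)=(x^{q^n}-1)\,p_n(x)+(1-T^{1-q^n})\,x^{q^n}p_{n-1}(x)\qquad(n\ge0).$$ For a finite set $S\subset\{0,1,2,\dots\}$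 let $M(S)=\{i\in S: i-1\notin S\}$, $w(S)=\sum_{i\in S}q^i$ and $m(S)=\prod_{i\in M(S)}T^{q^i-1}$. Let $\phi$ be a rank 2 Drinfeld module over $L$ with $\mathbb F_q\subset\ker(\phi_T)$ (equivalently, $\phi_T=T-(T+\Delta)\tau+\Delta\tau^2$ with $\Delta\neq 0$), and assume $\Delta\in A$. Then: (i) For every $n\ge0$, $p_n(-\Delta/T^q)=(-1)^n b_n$. (ii) For every $n\ge0$, $\displaystyle p_n(x)=\sum_{S\subset\{0,\dots,n-1\}}(-1)^{n-|S|}\frac{x^{w(S)}}{m(S)}$. (iii) Let $\mathfrak p\in A$ be a prime of degree $n$ that does not divide both $T$ and $\Delta$. Then $\phi$ is supersingular at $\mathfrak p$ if and only if $p_n(-\Delta/T^q)\equiv0\pmod{\mathfrak p}$. Here $\phi$ is supersingular at $\mathfrak p$ if its coefficientwise reduction modulo $\mathfrak p$ is a Drinfeld module of rank 2 over $A/\mathfrak p$ (that is, $\mathfrak p\nmid\Delta$) and this reduction has no nonzero $\mathfrak p$-torsion over an algebraic closure of $A/\mathfrak p$; and, for $x\in K$, $x\equiv0\pmod{\mathfrak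 p}$ means $x\in\mathfrak pA_{(\mathfrak p)}$, where $A_{(\mathfrak p)}$ is the localization of $A$ at the prime ideal generated by $\mathfrak p$. -/

import Mathlib

open Polynomial

/-- A Drinfeld `𝔽_q[T]`-module of rank 2 over an `𝔽_q[T]`-field `L`, where `q = #Fq`, the ring
`𝔽_q[T]` is `Fq[X]` (so `T` is `X`) and the structure homomorphism is `algebraMap Fq[X] L`.
The ring `L{τ}` of polynomials in `τ : z ↦ z ^ q` under addition and composition is realized
inside `L[X]` (`τ ^ i` is the polynomial `X ^ (q ^ i)` and the product is `Polynomial.comp`), so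
an `𝔽_q`-linear ring homomorphism `a ↦ φ_a` with `φ_T = T + g τ + Δ τ²`, `Δ ≠ 0`, is exactly the
data below (these laws force every `φ_a` into `L{τ}`). -/
structure DrinfeldModule (Fq : Type*) [Field Fq] [Fintype Fq] (L : Type*) [Field L]
    [Algebra Fq[X] L] where
  /-- The map `a ↦ φ_a`. -/
  toFun : Fq[X] → L[X]
  /-- The coefficient `g` of `τ` in `φ_T`. -/
  g : L
  /-- The coefficient `Δ` of `τ²` in `φ_T`. -/
  Δ : L
  Δ_ne_zero : Δ ≠ 0
  map_add : ∀ a b, toFun (a + b) = toFun a + toFun b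
  map_mul : ∀ a b, toFun (a * b) = (toFun a).comp (toFun b)
  map_const : ∀ c : Fq, toFun (C c) = C (algebraMap Fq[X] L (C c)) * X
  map_T : toFun X = C (algebraMap Fq[X] L X) * X + C g * X ^ Fintype.card Fq
    + C Δ * X ^ (Fintype.card Fq ^ 2)

namespace DrinfeldModule

variable {Fq : Type*} [Field Fq] [Fintype Fq] {L : Type*} [Field L] [Algebra Fq[X] L]

/-- `φ` lies in the family `𝓕_δ`: the line `𝔽_q δ` is contained in `ker φ_T`. -/
def InFamily (δ : L) (φ : DrinfeldModule Fq L) : Prop :=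
  ∀ c : Fq, (φ.toFun X).eval (algebraMap Fq[X] L (C c) * δ) = 0

/-- The `a`-torsion points of `φ` in an algebraic closure of `L`. -/
def torsion (φ : DrinfeldModule Fq L) (a : Fq[X]) : Set (AlgebraicClosure L) :=
  {x | aeval x (φ.toFun a) = 0}

/-- `e` is the exponential series of `φ`: an `𝔽_q`-linear power series `z + ⋯` such that
`e(T z) = φ_T(e(z))`. -/
def IsExp (φ : DrinfeldModule Fq L) (e : PowerSeries L) : Prop :=
  (∀ m : ℕ, (∀ n : ℕ, m ≠ Fintype.card Fq ^ n) → PowerSeries.coeff m e = 0) ∧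
  PowerSeries.coeff 1 e = 1 ∧
  PowerSeries.rescale (algebraMap Fq[X] L X) e = aeval e (φ.toFun X)

section existence

theorem coeff_pow_q (e : PowerSeries L) (k m : ℕ) :
    PowerSeries.coeff m (e ^ (Fintype.card Fq ^ k)) =
      if Fintype.card Fq ^ k ∣ m then
        (PowerSeries.coeff (m / Fintype.card Fq ^ k) e) ^ (Fintype.card Fq ^ k) else 0 := by
  obtain ⟨p, hp⟩ := CharP.exists Fq
  obtain ⟨r, hpp, hr⟩ := FiniteField.card Fq p
  have := Fact.mk hpp
  have : CharP L p := by
    have : Function.Injective ((algebraMap Fq[X] L).comp (C : Fq →+* Fq[X])) :=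
      RingHom.injective _
    exact charP_of_injective_ringHom this p
  have h : PowerSeries.map (iterateFrobenius L p (r * k))
      (PowerSeries.expand (p ^ (r * k : ℕ)) (pow_ne_zero _ hpp.ne_zero) e) = e ^ p ^ (r * k : ℕ) :=
    MvPowerSeries.map_iterateFrobenius_expand p hpp.ne_zero e (r * k)
  rw [hr, ← pow_mul, ← h, PowerSeries.coeff_map, PowerSeries.coeff_expand]
  split_ifs
  · simp [iterateFrobenius_def]
  · rw [map_zero]

theorem coeff_card_pow (e : PowerSeries L) (k n : ℕ) :
    PowerSeries.coeff (Fintype.card Fq ^ n) (e ^ (Fintype.card Fq ^ k)) =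
      if k ≤ n then
        (PowerSeries.coeff (Fintype.card Fq ^ (n - k)) e) ^ (Fintype.card Fq ^ k) else 0 := by
  have hq : 1 < Fintype.card Fq := Fintype.one_lt_card
  simp only [coeff_pow_q, Nat.pow_dvd_pow_iff_le_right hq]
  split_ifs with h
  · rw [Nat.pow_div h (by omega)]
  · rfl

theorem functional_iff (φ : DrinfeldModule Fq L) (e : PowerSeries L) :
    PowerSeries.rescale (algebraMap Fq[X] L X) e = aeval e (φ.toFun X) ↔
      ∀ m : ℕ, algebraMap Fq[X] L X ^ m * PowerSeries.coeff m e =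
        algebraMap Fq[X] L X * PowerSeries.coeff m e
          + φ.g * PowerSeries.coeff m (e ^ Fintype.card Fq ^ 1)
          + φ.Δ * PowerSeries.coeff m (e ^ Fintype.card Fq ^ 2) := by
  rw [PowerSeries.ext_iff]
  refine forall_congr' fun m => ?_
  rw [PowerSeries.coeff_rescale, φ.map_T]
  simp only [_root_.map_add, _root_.map_mul, aeval_C, aeval_X, map_pow, pow_one,
    PowerSeries.algebraMap_apply, Algebra.algebraMap_self, RingHom.id_apply,
    PowerSeries.coeff_C_mul]

theorem pow_sub_ne_zero (hT : Function.Injective (algebraMap Fq[X] L)) (n : ℕ) (hn : n ≠ 0) :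
    algebraMap Fq[X] L X ^ (Fintype.card Fq ^ n) - algebraMap Fq[X] L X ≠ 0 := by
  rw [← map_pow, ← map_sub, map_ne_zero_iff _ hT]
  have hq : 1 < Fintype.card Fq := Fintype.one_lt_card
  intro h
  have h1 := FiniteField.X_pow_card_pow_sub_X_ne_zero (K' := Fq) (n := n) hn hq
  exact h1 h

/-- The coefficients of the exponential series. -/
noncomputable def expCoeff (φ : DrinfeldModule Fq L) : ℕ → L
  | 0 => 1
  | 1 => φ.g / (algebraMap Fq[X] L X ^ (Fintype.card Fq ^ 1) - algebraMap Fq[X] L X)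
  | n + 2 => (φ.g * expCoeff φ (n + 1) ^ Fintype.card Fq
      + φ.Δ * expCoeff φ n ^ (Fintype.card Fq ^ 2))
      / (algebraMap Fq[X] L X ^ (Fintype.card Fq ^ (n + 2)) - algebraMap Fq[X] L X)

theorem existsUnique_isExp (hT : Function.Injective (algebraMap Fq[X] L))
    (φ : DrinfeldModule Fq L) : ∃! e, φ.IsExp e := by
  have hq : 1 < Fintype.card Fq := Fintype.one_lt_card
  have hinj := Nat.pow_right_injective hq
  refine existsUnique_of_exists_of_unique ?_ ?_
  · let e : PowerSeries L := PowerSeries.mk fun m =>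
      if m = Fintype.card Fq ^ Nat.log (Fintype.card Fq) m then
        φ.expCoeff (Nat.log (Fintype.card Fq) m) else 0
    have he1 : ∀ n, PowerSeries.coeff (Fintype.card Fq ^ n) e = φ.expCoeff n := by
      intro n
      simp [e, Nat.log_pow hq]
    have he0 : ∀ m : ℕ, (∀ n : ℕ, m ≠ Fintype.card Fq ^ n) → PowerSeries.coeff m e = 0 := by
      intro m hm
      simp only [e, PowerSeries.coeff_mk]
      rw [if_neg (hm _)]
    refine ⟨e, he0, by simpa [expCoeff] using he1 0, (functional_iff φ e).2 fun m => ?_⟩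
    by_cases hm : ∃ n, m = Fintype.card Fq ^ n
    · obtain ⟨n, rfl⟩ := hm
      rw [coeff_card_pow, coeff_card_pow]
      simp only [he1]
      match n with
      | 0 => simp
      | 1 =>
        have := pow_sub_ne_zero hT 1 one_ne_zero
        simp only [expCoeff, le_refl, if_true, Nat.sub_self, one_pow]
        rw [if_neg (by norm_num)]
        field_simp
        ring
      | n + 2 =>
        have := pow_sub_ne_zero hT (n + 2) (by omega)
        rw [if_pos (by omega), if_pos (by omega)]
        simp only [expCoeff, Nat.add_sub_cancel, pow_one, show n + 2 - 1 = n + 1 by omega]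
        field_simp
        ring
    · push Not at hm
      have key : ∀ k ≠ 0, PowerSeries.coeff m (e ^ Fintype.card Fq ^ k) = 0 := by
        intro k _
        rw [coeff_pow_q]
        split_ifs with h
        · rw [he0 _ fun n hn => hm (n + k) ?_, zero_pow (pow_ne_zero _ (by omega))]
          rw [pow_add, ← hn, Nat.div_mul_cancel h]
        · rfl
      rw [he0 m hm, key 1 (by omega), key 2 (by omega)]
      simp
  · rintro e e' ⟨h0, h1, h2⟩ ⟨h0', h1', h2'⟩
    rw [functional_iff] at h2 h2'
    have key : ∀ n, PowerSeries.coeff (Fintype.card Fq ^ n) e =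
        PowerSeries.coeff (Fintype.card Fq ^ n) e' := by
      intro n
      induction n using Nat.strong_induction_on with
      | _ n ih =>
        rcases Nat.eq_zero_or_pos n with rfl | hn
        · simp [h1, h1']
        · have a := h2 (Fintype.card Fq ^ n)
          have b := h2' (Fintype.card Fq ^ n)
          rw [coeff_card_pow, coeff_card_pow] at a b
          rw [ih (n - 1) (by omega), ih (n - 2) (by omega)] at a
          refine mul_left_cancel₀ (pow_sub_ne_zero hT n hn.ne') ?_
          linear_combination a - b
    ext m
    by_cases hm : ∃ n, m = Fintype.card Fq ^ n
    · obtain ⟨n, rfl⟩ := hm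
      exact key n
    · push Not at hm
      rw [h0 m hm, h0' m hm]

end existence

/-- `l` is the logarithm series of `φ`: the formal inverse of its exponential series. -/
def IsLog (φ : DrinfeldModule Fq L) (l : PowerSeries L) : Prop :=
  ∃ e, φ.IsExp e ∧ l.subst e = PowerSeries.X ∧ e.subst l = PowerSeries.X

theorem existsUnique_isLog (hT : Function.Injective (algebraMap Fq[X] L))
    (φ : DrinfeldModule Fq L) : ∃! l, φ.IsLog l := by
  obtain ⟨e, he, hu⟩ := existsUnique_isExp hT φ
  have h0 : PowerSeries.constantCoeff e = 0 := by
    rw [← PowerSeries.coeff_zero_eq_constantCoeff_apply]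
    exact he.1 0 fun n => (pow_ne_zero n Fintype.card_ne_zero).symm
  have h1 : IsUnit (PowerSeries.coeff 1 e) := by simp [he.2.1]
  have hR := PowerSeries.subst_substInvOfIsUnit_right e h0 h1
  have hL := PowerSeries.subst_substInvOfIsUnit_left e h0 h1
  have hs := PowerSeries.HasSubst.substInvOfIsUnit e h1
  refine ⟨e.substInvOfIsUnit h1, ⟨e, he, hL, hR⟩, ?_⟩
  rintro l ⟨e', he', hl, -⟩
  obtain rfl := hu e' he'
  have h := PowerSeries.subst_comp_subst_apply
    (PowerSeries.HasSubst.of_constantCoeff_zero' h0) hs l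
  rw [hl, hR, PowerSeries.subst_X hs, PowerSeries.X_subst] at h
  exact h.symm

/-- The logarithm series `log_φ` (in generic characteristic, the unique series with `IsLog`). -/
noncomputable def log (φ : DrinfeldModule Fq L) : PowerSeries L :=
  Classical.epsilon φ.IsLog

/-- `𝔞_δ(n) = T ∑_{j ≤ n} β_j δ^(q^j)`, where `log_φ(z) = ∑ β_j z^(q^j)`. -/
noncomputable def periodCoeff (φ : DrinfeldModule Fq L) (δ : L) (n : ℕ) : L :=
  algebraMap Fq[X] L X * ∑ j ∈ Finset.range (n + 1),
    PowerSeries.coeff (Fintype.card Fq ^ j) φ.log * δ ^ (Fintype.card Fq ^ j)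

/-- `𝔟_n = L_n 𝔞_n / T^(1 + q + ⋯ + q^n)`, where `𝔞_n = 𝔞_1(n)`, `L_n = [n][n-1]⋯[1]` and
`[i] = T^(q^i) - T`. -/
noncomputable def normalizedPeriodCoeff (φ : DrinfeldModule Fq L) (n : ℕ) : L :=
  algebraMap Fq[X] L (∏ i ∈ Finset.Icc 1 n, (X ^ (Fintype.card Fq ^ i) - X)) * φ.periodCoeff 1 n
    / algebraMap Fq[X] L X ^ (∑ i ∈ Finset.range (n + 1), Fintype.card Fq ^ i)

end DrinfeldModule

section reduction

variable {Fq : Type*} [Field Fq]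

instance isMaximal_span_irreducible (P : Fq[X]) [hP : Fact (Irreducible P)] :
    (Ideal.span {P}).IsMaximal :=
  PrincipalIdealRing.isMaximal_of_irreducible hP.out

noncomputable instance residueFieldInst (P : Fq[X]) [Fact (Irreducible P)] :
    Field (Fq[X] ⧸ Ideal.span {P}) :=
  Ideal.Quotient.field _

variable [Fintype Fq] {L : Type*} [Field L] [Algebra Fq[X] L]

/-- `ψ` is the reduction at the prime `P` of `φ`: every `φ_a` has coefficients in `𝔽_q[T]`, and
`ψ_a` is obtained by reducing them modulo `P`. -/
def DrinfeldModule.IsReductionAt (φ : DrinfeldModule Fq L) (P : Fq[X]) [Fact (Irreducible P)]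
    (ψ : DrinfeldModule Fq (Fq[X] ⧸ Ideal.span {P})) : Prop :=
  ∀ a : Fq[X], ∃ f : Fq[X][X], f.map (algebraMap Fq[X] L) = φ.toFun a ∧
    f.map (Ideal.Quotient.mk (Ideal.span {P})) = ψ.toFun a

/-- `φ` is supersingular at the prime `P`: it reduces to a rank 2 Drinfeld module over the field
`𝔽_q[T]/(P)`, and this reduction has no nonzero `P`-torsion. -/
def DrinfeldModule.IsSupersingularAt (φ : DrinfeldModule Fq L) (P : Fq[X])
    [Fact (Irreducible P)] : Prop :=
  ∃ ψ : DrinfeldModule Fq (Fq[X] ⧸ Ideal.span {P}), φ.IsReductionAt P ψ ∧ ψ.torsion P = {0}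

/-- `x ≡ 0 mod P` for `x` in the fraction field `𝔽_q(T)`: `x` lies in the ideal generated by `P`
in the localization of `𝔽_q[T]` at `(P)`. -/
def IsZeroMod (P : Fq[X]) (x : RatFunc Fq) : Prop :=
  ∃ a b : Fq[X], ¬ P ∣ b ∧
    x * algebraMap Fq[X] (RatFunc Fq) b = algebraMap Fq[X] (RatFunc Fq) (P * a)

end reduction

section BassaBeelen

variable (Fq : Type*) [Field Fq] [Fintype Fq]

/-- The sequence `p_{k-1}`, `k ≥ 0`, of Bassa–Beelen polynomials, starting with `p_{-1} = 0` and
`p_0 = 1`. -/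
noncomputable def bassaBeelenAux : ℕ → (RatFunc Fq)[X]
  | 0 => 0
  | 1 => 1
  | n + 2 => (X ^ (Fintype.card Fq ^ n) - 1) * bassaBeelenAux (n + 1)
      + C (1 - (RatFunc.X : RatFunc Fq) ^ (1 - (Fintype.card Fq : ℤ) ^ n))
        * X ^ (Fintype.card Fq ^ n) * bassaBeelenAux n

/-- The Bassa–Beelen polynomial `p_n`, `n ≥ 0`. -/
noncomputable def bassaBeelen (n : ℕ) : (RatFunc Fq)[X] := bassaBeelenAux Fq (n + 1)

/-- `M(S) = {i ∈ S : i - 1 ∉ S}` (with `-1 ∉ S`). -/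
def blockStarts (S : Finset ℕ) : Finset ℕ := S.filter fun i => i = 0 ∨ i - 1 ∉ S

/-- `w(S) = ∑_{i ∈ S} q^i`. -/
def setWeight (S : Finset ℕ) : ℕ := ∑ i ∈ S, Fintype.card Fq ^ i

/-- `m(S) = ∏_{i ∈ M(S)} T^(q^i - 1)`. -/
noncomputable def setMonomial (S : Finset ℕ) : Fq[X] :=
  ∏ i ∈ blockStarts S, X ^ (Fintype.card Fq ^ i - 1)

end BassaBeelen

/-! All three parts rest on one identity of twisted power series in `τ`, namely `log_φ ⋆ φ_a = a ·
log_φ`. For `a = T` it is a three-term recursion for the coefficients `β_n`, and it identifies the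
series built from `logCoeff` with the inverse of the exponential.

For (i), `𝔽_q ⊂ ker φ_T` means `g = -(T + Δ)`. With this `g` the recursion for `β_n` telescopes, `T
β_n = u_n - u_{n-1}` with `u_n = β_n T^(q^n) - β_{n-1} Δ^(q^(n-1))`. Hence the partial sums of the
`β_j` satisfy a three-term recursion of their own, which after normalization is the Bassa–Beelen
recursion at `x = -Δ/T^q`, up to the sign `(-1)^n`.

For (ii), split the subsets of `{0, …, n+1}` according to whether they contain `n+1` and `n`; the
sum then satisfies the recursion defining `p_{n+2}`.

For (iii), let `d = deg P` and let `ψ` be the reduction of `φ`. Since `ψ_P` commutes with `ψ_T`, the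
lowest nonzero coefficient of `ψ_P` sits in degree `d` or `2d`, so `ψ` is supersingular exactly when
the coefficient of `τ^d` in `ψ_P` vanishes (`torsion_self_eq_zero_iff`). Clear denominators in the
`d`-th coefficient of `log_φ ⋆ φ_P = P · log_φ` and read it modulo `P²`: the coefficient `l_d` of
`τ^d` in `φ_P` agrees modulo `P`, up to a unit, with the numerator `r_d` of `β_d`
(`tauCoeff_natDegree_eq_zero_iff`). Because `P` divides `T^(q^d) - T`, the telescoped formula shows
that `r_d` and the numerator of `p_d(-Δ/T^q)` vanish modulo `P` together when `P ∤ T`. If `P ∣ T`,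
both sides of (iii) are false. -/

/-- Induction on `a ∈ R[T]` through constants, sums and multiplication by `T`. -/
@[elab_as_elim]
theorem Polynomial.induction_X_mul {R : Type*} [CommSemiring R] {p : R[X] → Prop}
    (hC : ∀ c, p (C c)) (hadd : ∀ a b, p a → p b → p (a + b)) (hX : ∀ a, p a → p (X * a))
    (a : R[X]) : p a := by
  refine Polynomial.induction_on a hC hadd fun n c h => ?_
  convert! hX _ h using 1
  ring

/-! ### Twisted power series in `τ` -/

section TwistedProduct

variable {R : Type*} [CommRing R]

/-- The product `(a ⋆ b)_n = ∑_{i + j = n} a_i σ^i(b_j)` of twisted power series `∑ a_i τ^i`,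
where `τ x = σ(x) τ`. -/
def twistedMul (σ : R →+* R) (a b : ℕ → R) (n : ℕ) : R :=
  ∑ x ∈ Finset.HasAntidiagonal.antidiagonal n, a x.1 * (σ ^ x.1) (b x.2)

theorem twistedMul_eq_sum_range (σ : R →+* R) (a b : ℕ → R) (n : ℕ) :
    twistedMul σ a b n = ∑ i ∈ Finset.range (n + 1), a i * (σ ^ i) (b (n - i)) :=
  Finset.Nat.sum_antidiagonal_eq_sum_range_succ_mk _ n

theorem twistedMul_assoc (σ : R →+* R) (a b c : ℕ → R) :
    twistedMul σ (twistedMul σ a b) c = twistedMul σ a (twistedMul σ b c) := by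
  funext n
  simp only [twistedMul, Finset.sum_mul, map_sum, Finset.mul_sum, Finset.sum_sigma']
  refine Finset.sum_nbij' (fun x => ⟨(x.2.1, x.2.2 + x.1.2), (x.2.2, x.1.2)⟩)
    (fun x => ⟨(x.1.1 + x.2.1, x.2.2), (x.1.1, x.2.1)⟩) ?_ ?_ ?_ ?_ ?_
  · rintro ⟨⟨a, b⟩, c, d⟩
    simp only [Finset.mem_sigma, Finset.HasAntidiagonal.mem_antidiagonal, and_true]
    omega
  · rintro ⟨⟨a, b⟩, c, d⟩
    simp only [Finset.mem_sigma, Finset.HasAntidiagonal.mem_antidiagonal, and_true]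
    omega
  · rintro ⟨⟨a, b⟩, c, d⟩; simp only [Finset.mem_sigma, Finset.HasAntidiagonal.mem_antidiagonal]
    rintro ⟨-, rfl⟩; rfl
  · rintro ⟨⟨a, b⟩, c, d⟩; simp only [Finset.mem_sigma, Finset.HasAntidiagonal.mem_antidiagonal]
    rintro ⟨-, rfl⟩; rfl
  · rintro ⟨⟨i, j⟩, k, l⟩
    simp only [Finset.mem_sigma, Finset.HasAntidiagonal.mem_antidiagonal]
    rintro ⟨-, rfl⟩
    rw [_root_.map_mul, pow_add, RingHom.mul_def, RingHom.comp_apply, mul_assoc]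

theorem twistedMul_add_left (σ : R →+* R) (a b c : ℕ → R) (n : ℕ) :
    twistedMul σ (fun i => a i + b i) c n = twistedMul σ a c n + twistedMul σ b c n := by
  simp [twistedMul, add_mul, Finset.sum_add_distrib]

theorem twistedMul_add_right (σ : R →+* R) (a b c : ℕ → R) (n : ℕ) :
    twistedMul σ a (fun i => b i + c i) n = twistedMul σ a b n + twistedMul σ a c n := by
  simp [twistedMul, mul_add, Finset.sum_add_distrib]

theorem twistedMul_smul_left (σ : R →+* R) (t : R) (a b : ℕ → R) (n : ℕ) :
    twistedMul σ (fun i => t * a i) b n = t * twistedMul σ a b n := by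
  simp [twistedMul, mul_assoc, Finset.mul_sum]

end TwistedProduct

/-! ### `φ_a` and `log_φ` as twisted power series -/

namespace DrinfeldModule

section Frobenius

variable (Fq : Type*) [Field Fq] [Fintype Fq] (L : Type*) [Field L] [Algebra Fq[X] L]

/-- The endomorphism `x ↦ x ^ q` of an `𝔽_q[T]`-field. -/
noncomputable def frob : L →+* L :=
  letI : Algebra Fq L := ((algebraMap Fq[X] L).comp C).toAlgebra
  (FiniteField.frobeniusAlgHom Fq L : L →+* L)

theorem frob_apply (x : L) : frob Fq L x = x ^ Fintype.card Fq := rfl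

theorem frob_pow_apply (k : ℕ) (x : L) : (frob Fq L ^ k) x = x ^ Fintype.card Fq ^ k := by
  induction k with
  | zero => simp
  | succ k ih =>
    rw [pow_succ', RingHom.mul_def, RingHom.comp_apply, ih, frob_apply, ← pow_mul, ← pow_succ]

end Frobenius

variable {Fq : Type*} [Field Fq] [Fintype Fq] {L : Type*} [Field L] [Algebra Fq[X] L]

theorem frob_pow_C (k : ℕ) (c : Fq) :
    (frob Fq L ^ k) (algebraMap Fq[X] L (C c)) = algebraMap Fq[X] L (C c) := by
  rw [frob_pow_apply, ← map_pow, ← map_pow, FiniteField.pow_card_pow]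

variable (φ : DrinfeldModule Fq L)

/-- The coefficients of `φ_T` as a polynomial in `τ`. -/
noncomputable def tauCoeffT : ℕ → L
  | 0 => algebraMap Fq[X] L X
  | 1 => φ.g
  | 2 => φ.Δ
  | _ + 3 => 0

/-- The coefficient of `τ^i` in `φ_a`. -/
noncomputable def tauCoeff (a : Fq[X]) (i : ℕ) : L :=
  (φ.toFun a).coeff (Fintype.card Fq ^ i)

theorem twistedMul_tauCoeffT_left (b : ℕ → L) (n : ℕ) :
    twistedMul (frob Fq L) φ.tauCoeffT b n = algebraMap Fq[X] L X * b n
      + φ.g * (if 1 ≤ n then b (n - 1) ^ Fintype.card Fq ^ 1 else 0)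
      + φ.Δ * (if 2 ≤ n then b (n - 2) ^ Fintype.card Fq ^ 2 else 0) := by
  rw [twistedMul_eq_sum_range]
  simp only [frob_pow_apply]
  match n with
  | 0 => simp [tauCoeffT]
  | 1 => simp [tauCoeffT, Finset.sum_range_succ]
  | n + 2 =>
    rw [Finset.sum_range_succ', Finset.sum_range_succ', Finset.sum_range_succ',
      Finset.sum_eq_zero (fun i _ => by simp [tauCoeffT])]
    simp [tauCoeffT]
    ring

theorem twistedMul_tauCoeffT_right (b : ℕ → L) (n : ℕ) :
    twistedMul (frob Fq L) b φ.tauCoeffT n =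
      b n * algebraMap Fq[X] L X ^ Fintype.card Fq ^ n
      + (if 1 ≤ n then b (n - 1) * φ.g ^ Fintype.card Fq ^ (n - 1) else 0)
      + (if 2 ≤ n then b (n - 2) * φ.Δ ^ Fintype.card Fq ^ (n - 2) else 0) := by
  rw [twistedMul_eq_sum_range]
  simp only [frob_pow_apply]
  match n with
  | 0 => simp [tauCoeffT]
  | 1 => simp [tauCoeffT, Finset.sum_range_succ]; ring
  | n + 2 =>
    rw [Finset.sum_range_succ, Finset.sum_range_succ, Finset.sum_range_succ,
      Finset.sum_eq_zero (fun i hi => ?_)]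
    · simp [tauCoeffT, show n + 2 - n = 2 by omega, show n + 2 - (n + 1) = 1 by omega]
      ring
    · rw [Finset.mem_range] at hi
      obtain ⟨k, hk⟩ : ∃ k, n + 2 - i = k + 3 := ⟨n - i - 1, by omega⟩
      rw [hk, tauCoeffT, zero_pow (pow_ne_zero _ Fintype.card_ne_zero), mul_zero]

theorem coeff_polynomial_pow_q (f : L[X]) (k m : ℕ) :
    (f ^ (Fintype.card Fq ^ k)).coeff m = if Fintype.card Fq ^ k ∣ m then
        (f.coeff (m / Fintype.card Fq ^ k)) ^ (Fintype.card Fq ^ k) else 0 := by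
  have := coeff_pow_q (Fq := Fq) (f : PowerSeries L) k m
  rwa [← Polynomial.coe_pow, Polynomial.coeff_coe, Polynomial.coeff_coe] at this

theorem coeff_polynomial_card_pow (f : L[X]) (k n : ℕ) :
    (f ^ (Fintype.card Fq ^ k)).coeff (Fintype.card Fq ^ n) = if k ≤ n then
        (f.coeff (Fintype.card Fq ^ (n - k))) ^ (Fintype.card Fq ^ k) else 0 := by
  have := coeff_card_pow (Fq := Fq) (f : PowerSeries L) k n
  rwa [← Polynomial.coe_pow, Polynomial.coeff_coe, Polynomial.coeff_coe] at this

theorem toFun_X_mul (a : Fq[X]) : φ.toFun (X * a) =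
    C (algebraMap Fq[X] L X) * φ.toFun a + C φ.g * φ.toFun a ^ Fintype.card Fq ^ 1
      + C φ.Δ * φ.toFun a ^ Fintype.card Fq ^ 2 := by
  rw [φ.map_mul, φ.map_T]
  simp

/-- The shape of `φ_T` and the composition law force every `φ_a` into `L{τ}`, so no information is
lost in passing to `tauCoeff`. -/
theorem toFun_coeff_eq_zero (a : Fq[X]) :
    ∀ m, (∀ i, m ≠ Fintype.card Fq ^ i) → (φ.toFun a).coeff m = 0 := by
  refine Polynomial.induction_X_mul ?_ ?_ ?_ a
  · intro c m hm
    rw [φ.map_const, coeff_C_mul, coeff_X, if_neg, mul_zero]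
    simpa using (hm 0).symm
  · intro a b ha hb m hm
    rw [φ.map_add, coeff_add, ha m hm, hb m hm, add_zero]
  · intro a ha m hm
    have key : ∀ k, (φ.toFun a ^ Fintype.card Fq ^ k).coeff m = 0 := by
      intro k
      rw [coeff_polynomial_pow_q]
      split_ifs with h
      · rw [ha _ fun i hi => hm (i + k) ?_, zero_pow (pow_ne_zero _ Fintype.card_ne_zero)]
        rw [pow_add, ← hi, Nat.div_mul_cancel h]
      · rfl
    rw [toFun_X_mul, coeff_add, coeff_add, coeff_C_mul, coeff_C_mul, coeff_C_mul, key, key, ha m hm]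
    simp

theorem tauCoeff_add (a b : Fq[X]) :
    φ.tauCoeff (a + b) = fun i => φ.tauCoeff a i + φ.tauCoeff b i := by
  funext i
  simp [tauCoeff, φ.map_add]

theorem tauCoeff_C (c : Fq) (i : ℕ) :
    φ.tauCoeff (C c) i = if i = 0 then algebraMap Fq[X] L (C c) else 0 := by
  have hq : Fintype.card Fq ≠ 1 := Fintype.one_lt_card.ne'
  rw [tauCoeff, φ.map_const, coeff_C_mul, coeff_X]
  by_cases h : i = 0
  · simp [h]
  · rw [if_neg, if_neg h, mul_zero]
    rw [eq_comm, Nat.pow_eq_one]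
    tauto

theorem tauCoeff_X_mul (a : Fq[X]) :
    φ.tauCoeff (X * a) = twistedMul (frob Fq L) φ.tauCoeffT (φ.tauCoeff a) := by
  funext n
  rw [twistedMul_tauCoeffT_left, tauCoeff, toFun_X_mul, coeff_add, coeff_add, coeff_C_mul,
    coeff_C_mul, coeff_C_mul, coeff_polynomial_card_pow, coeff_polynomial_card_pow]
  rfl

theorem twistedMul_tauCoeff_C_right (b : ℕ → L) (c : Fq) (n : ℕ) :
    twistedMul (frob Fq L) b (φ.tauCoeff (C c)) n = algebraMap Fq[X] L (C c) * b n := by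
  rw [twistedMul_eq_sum_range, Finset.sum_range_succ, Finset.sum_eq_zero fun i hi => ?_]
  · rw [tauCoeff_C, if_pos (Nat.sub_self n), frob_pow_C, zero_add, mul_comm]
  · rw [Finset.mem_range] at hi
    rw [tauCoeff_C, if_neg (by omega), map_zero, mul_zero]

theorem tauCoeff_X : φ.tauCoeff X = φ.tauCoeffT := by
  funext n
  have := φ.tauCoeff_X_mul (C 1)
  rw [C_1, mul_one] at this
  rw [this, ← C_1, twistedMul_tauCoeff_C_right, C_1, map_one, one_mul]

/-- Composition is expanded in coefficients only when `φ_T` is on the left. The version on the right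
follows by induction on `a` and associativity; comparing the two says that `φ_a` commutes with
`φ_T`. -/
theorem tauCoeff_mul_X (a : Fq[X]) :
    φ.tauCoeff (a * X) = twistedMul (frob Fq L) (φ.tauCoeff a) φ.tauCoeffT := by
  refine Polynomial.induction_X_mul ?_ ?_ ?_ a
  · intro c
    funext n
    rw [mul_comm, tauCoeff_X_mul, twistedMul_tauCoeff_C_right, twistedMul_eq_sum_range,
      Finset.sum_range_succ', Finset.sum_eq_zero fun i _ => ?_]
    · simp [tauCoeff_C]
    · simp [tauCoeff_C]
  · intro a b ha hb
    funext n
    rw [add_mul, tauCoeff_add, ha, hb, tauCoeff_add, twistedMul_add_left]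
  · intro a ha
    rw [mul_assoc, tauCoeff_X_mul, ha, ← twistedMul_assoc, ← tauCoeff_X_mul]

/-- The relation `b ⋆ φ_T = T b` propagates to all `a`, as both sides are additive and
multiplicative in `a`. It is used with `b` the logarithm and `a = P`. -/
theorem twistedMul_tauCoeff_eq (b : ℕ → L)
    (hb : ∀ n, twistedMul (frob Fq L) b φ.tauCoeffT n = algebraMap Fq[X] L X * b n)
    (a : Fq[X]) (n : ℕ) :
    twistedMul (frob Fq L) b (φ.tauCoeff a) n = algebraMap Fq[X] L a * b n := by
  revert n
  refine Polynomial.induction_X_mul ?_ ?_ ?_ a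
  · intro c n
    rw [twistedMul_tauCoeff_C_right]
  · intro a a' h h' n
    rw [tauCoeff_add, twistedMul_add_right, h, h', _root_.map_add, add_mul]
  · intro a h n
    rw [tauCoeff_X_mul, ← twistedMul_assoc, funext hb, twistedMul_smul_left, h,
      _root_.map_mul, mul_assoc]

theorem tauCoeff_zero (a : Fq[X]) : φ.tauCoeff a 0 = algebraMap Fq[X] L a := by
  refine Polynomial.induction_X_mul ?_ ?_ ?_ a
  · intro c; simp [tauCoeff_C]
  · intro a b ha hb; simp [tauCoeff_add, ha, hb]
  · intro a ha; simp [tauCoeff_X_mul, twistedMul_tauCoeffT_left, ha]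

/-- The coefficients of the logarithm series. -/
noncomputable def logCoeff : ℕ → L
  | 0 => 1
  | 1 => φ.g / (algebraMap Fq[X] L X - algebraMap Fq[X] L X ^ (Fintype.card Fq ^ 1))
  | n + 2 => (logCoeff (n + 1) * φ.g ^ Fintype.card Fq ^ (n + 1)
      + logCoeff n * φ.Δ ^ Fintype.card Fq ^ n)
      / (algebraMap Fq[X] L X - algebraMap Fq[X] L X ^ (Fintype.card Fq ^ (n + 2)))

theorem sub_pow_ne_zero (hT : Function.Injective (algebraMap Fq[X] L)) (n : ℕ) (hn : n ≠ 0) :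
    algebraMap Fq[X] L X - algebraMap Fq[X] L X ^ (Fintype.card Fq ^ n) ≠ 0 := by
  rw [← neg_sub]
  exact neg_ne_zero.2 (pow_sub_ne_zero hT n hn)

theorem twistedMul_logCoeff_tauCoeffT (hT : Function.Injective (algebraMap Fq[X] L)) (n : ℕ) :
    twistedMul (frob Fq L) φ.logCoeff φ.tauCoeffT n = algebraMap Fq[X] L X * φ.logCoeff n := by
  rw [twistedMul_tauCoeffT_right]
  match n with
  | 0 => simp [logCoeff]
  | 1 =>
    have := sub_pow_ne_zero hT 1 one_ne_zero
    simp only [logCoeff, le_refl, if_true, Nat.sub_self]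
    rw [if_neg (by norm_num)]
    field_simp
    ring
  | n + 2 =>
    have := sub_pow_ne_zero hT (n + 2) (by omega)
    rw [if_pos (by omega), if_pos (by omega)]
    simp only [logCoeff, Nat.add_sub_cancel, show n + 2 - 1 = n + 1 by omega]
    field_simp
    ring

theorem IsExp.tauCoeffT_mul {φ : DrinfeldModule Fq L} {e : PowerSeries L} (he : φ.IsExp e) :
    twistedMul (frob Fq L) φ.tauCoeffT (fun n => PowerSeries.coeff (Fintype.card Fq ^ n) e) =
      fun n => algebraMap Fq[X] L X ^ Fintype.card Fq ^ n
        * PowerSeries.coeff (Fintype.card Fq ^ n) e := by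
  funext n
  rw [twistedMul_tauCoeffT_left, (functional_iff φ e).1 he.2.2, coeff_card_pow, coeff_card_pow]

/-- Put `c = log ⋆ e`. Bracketing `log ⋆ φ_T ⋆ e` in two ways gives `T c_n = T^(q^n) c_n`, hence
`c_n = 0` for `n ≥ 1`. -/
theorem IsExp.logCoeff_mul {φ : DrinfeldModule Fq L} (hT : Function.Injective (algebraMap Fq[X] L))
    {e : PowerSeries L} (he : φ.IsExp e) (n : ℕ) :
    twistedMul (frob Fq L) φ.logCoeff
      (fun n => PowerSeries.coeff (Fintype.card Fq ^ n) e) n = if n = 0 then 1 else 0 := by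
  split_ifs with hn
  · subst hn
    simp [twistedMul, logCoeff, he.2.1]
  · have h := congrFun (twistedMul_assoc (frob Fq L) φ.logCoeff φ.tauCoeffT
      (fun n => PowerSeries.coeff (Fintype.card Fq ^ n) e)) n
    rw [he.tauCoeffT_mul, funext (φ.twistedMul_logCoeff_tauCoeffT hT), twistedMul_smul_left] at h
    have h2 : twistedMul (frob Fq L) φ.logCoeff (fun n => algebraMap Fq[X] L X ^ Fintype.card Fq ^ n
        * PowerSeries.coeff (Fintype.card Fq ^ n) e) n = algebraMap Fq[X] L X ^ Fintype.card Fq ^ n *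
        twistedMul (frob Fq L) φ.logCoeff
          (fun n => PowerSeries.coeff (Fintype.card Fq ^ n) e) n := by
      rw [twistedMul_eq_sum_range, twistedMul_eq_sum_range, Finset.mul_sum]
      refine Finset.sum_congr rfl fun i hi => ?_
      rw [Finset.mem_range] at hi
      rw [_root_.map_mul, map_pow, frob_pow_apply, ← pow_mul, ← pow_add,
        show i + (n - i) = n by omega]
      ring
    rw [h2] at h
    refine (mul_eq_zero.1 ?_).resolve_left (sub_pow_ne_zero hT n hn)
    linear_combination h

/-- The series `∑ β_j z^(q^j)` with `β_j` the coefficients of the logarithm. -/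
noncomputable def logSeries : PowerSeries L :=
  PowerSeries.mk fun m => if m = Fintype.card Fq ^ Nat.log (Fintype.card Fq) m then
    φ.logCoeff (Nat.log (Fintype.card Fq) m) else 0

theorem coeff_logSeries (n : ℕ) :
    PowerSeries.coeff (Fintype.card Fq ^ n) φ.logSeries = φ.logCoeff n := by
  simp [logSeries, Nat.log_pow (Fintype.one_lt_card (α := Fq))]

theorem coeff_logSeries_of_ne (m : ℕ) (hm : ∀ n, m ≠ Fintype.card Fq ^ n) :
    PowerSeries.coeff m φ.logSeries = 0 := by
  rw [logSeries, PowerSeries.coeff_mk, if_neg (hm _)]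

theorem IsExp.logSeries_subst {φ : DrinfeldModule Fq L}
    (hT : Function.Injective (algebraMap Fq[X] L)) {e : PowerSeries L} (he : φ.IsExp e) :
    φ.logSeries.subst e = PowerSeries.X := by
  have hinj := Nat.pow_right_injective (Fintype.one_lt_card (α := Fq))
  have h0 : PowerSeries.constantCoeff e = 0 := by
    rw [← PowerSeries.coeff_zero_eq_constantCoeff_apply]
    exact he.1 0 fun n => (pow_ne_zero n Fintype.card_ne_zero).symm
  ext m
  rw [PowerSeries.coeff_subst' (PowerSeries.HasSubst.of_constantCoeff_zero' h0)]
  by_cases hm : ∃ n, m = Fintype.card Fq ^ n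
  · obtain ⟨n, rfl⟩ := hm
    rw [finsum_eq_sum_of_support_subset
      (s := (Finset.range (n + 1)).image (Fintype.card Fq ^ ·)),
      Finset.sum_image (fun _ _ _ _ h => hinj h)]
    · have h := he.logCoeff_mul hT n
      rw [twistedMul_eq_sum_range] at h
      rw [PowerSeries.coeff_X, Finset.sum_congr rfl fun i hi => ?_, h]
      · congr 1
        rw [Nat.pow_eq_one]
        simp [Fintype.one_lt_card.ne']
      · rw [Finset.mem_range] at hi
        rw [coeff_logSeries, coeff_card_pow, if_pos (by omega), frob_pow_apply, smul_eq_mul]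
    · intro d hd
      by_cases hd' : ∃ j, d = Fintype.card Fq ^ j
      · obtain ⟨j, rfl⟩ := hd'
        have : j ≤ n := by
          by_contra h
          rw [Function.mem_support, coeff_card_pow, if_neg h, smul_zero] at hd
          exact hd rfl
        simp only [Finset.coe_image, Set.mem_image, Finset.mem_coe, Finset.mem_range]
        exact ⟨j, by omega, rfl⟩
      · push Not at hd'
        rw [Function.mem_support, coeff_logSeries_of_ne _ _ hd', zero_smul] at hd
        exact absurd rfl hd
  · push Not at hm
    rw [PowerSeries.coeff_X, if_neg (by simpa using hm 0)]
    rw [← finsum_zero (M := L) (α := ℕ)]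
    congr 1
    funext d
    by_cases hd' : ∃ j, d = Fintype.card Fq ^ j
    · obtain ⟨j, rfl⟩ := hd'
      rw [coeff_pow_q]
      split_ifs with h
      · rw [he.1 _ fun n hn => hm (n + j) ?_, zero_pow (pow_ne_zero _ Fintype.card_ne_zero),
          smul_zero]
        rw [pow_add, ← hn, Nat.div_mul_cancel h]
      · rw [smul_zero]
    · push Not at hd'
      rw [coeff_logSeries_of_ne _ _ hd', zero_smul]

theorem log_eq_logSeries (hT : Function.Injective (algebraMap Fq[X] L)) :
    φ.log = φ.logSeries := by
  obtain ⟨l, hl, hu⟩ := existsUnique_isLog hT φ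
  rw [show φ.log = l from hu _ (Classical.epsilon_spec (p := φ.IsLog) ⟨l, hl⟩)]
  obtain ⟨e, he, -⟩ := existsUnique_isExp hT φ
  have h0 : PowerSeries.constantCoeff e = 0 := by
    rw [← PowerSeries.coeff_zero_eq_constantCoeff_apply]
    exact he.1 0 fun n => (pow_ne_zero n Fintype.card_ne_zero).symm
  have h1 : IsUnit (PowerSeries.coeff 1 e) := by simp [he.2.1]
  have hR := PowerSeries.subst_substInvOfIsUnit_right e h0 h1
  have hs := PowerSeries.HasSubst.substInvOfIsUnit e h1
  -- A left inverse of `e` equals its two-sided inverse: substitute that inverse into `logSeries ∘ e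
  -- = X`.
  have h := PowerSeries.subst_comp_subst_apply
    (PowerSeries.HasSubst.of_constantCoeff_zero' h0) hs φ.logSeries
  rw [he.logSeries_subst hT, hR, PowerSeries.subst_X hs, PowerSeries.X_subst] at h
  exact (hu _ ⟨e, he, he.logSeries_subst hT, h ▸ hR⟩).symm

end DrinfeldModule

/-! ### Telescoping the logarithm and the recursion for `𝔟_n` -/

namespace DrinfeldModule

variable {Fq : Type*} [Field Fq] [Fintype Fq] {L : Type*} [Field L] [Algebra Fq[X] L]
  (φ : DrinfeldModule Fq L)

theorem InFamily.g_eq {φ : DrinfeldModule Fq L} (hφ : φ.InFamily 1) :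
    φ.g = -(algebraMap Fq[X] L X + φ.Δ) := by
  have h := hφ 1
  rw [φ.map_T] at h
  simp only [map_one, mul_one, eval_add, eval_mul, eval_C, eval_X, eval_pow, one_pow] at h
  linear_combination h

theorem neg_add_pow_card_pow (x y : L) (k : ℕ) :
    (-(x + y)) ^ Fintype.card Fq ^ k = -(x ^ Fintype.card Fq ^ k + y ^ Fintype.card Fq ^ k) := by
  simp only [← frob_pow_apply Fq L, _root_.map_neg, _root_.map_add]

/-- With `g = -(T + Δ)` the recursion for `β_j` expresses `T β_j` as a difference of consecutive
values of the right-hand side, so the sum telescopes. -/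
theorem InFamily.mul_sum_logCoeff {φ : DrinfeldModule Fq L} (hφ : φ.InFamily 1)
    (hT : Function.Injective (algebraMap Fq[X] L)) (n : ℕ) :
    algebraMap Fq[X] L X * ∑ j ∈ Finset.range (n + 2), φ.logCoeff j =
      φ.logCoeff (n + 1) * algebraMap Fq[X] L X ^ Fintype.card Fq ^ (n + 1)
        - φ.logCoeff n * φ.Δ ^ Fintype.card Fq ^ n := by
  induction n with
  | zero =>
    have h := φ.twistedMul_logCoeff_tauCoeffT hT 1
    rw [twistedMul_tauCoeffT_right, hφ.g_eq] at h
    simp only [Finset.sum_range_succ, logCoeff, hφ.g_eq, le_refl, if_true, Nat.sub_self] at h ⊢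
    norm_num at h ⊢
    linear_combination -h
  | succ n ih =>
    have h := φ.twistedMul_logCoeff_tauCoeffT hT (n + 2)
    rw [twistedMul_tauCoeffT_right, hφ.g_eq, neg_add_pow_card_pow, if_pos (by omega),
      if_pos (by omega), show n + 2 - 1 = n + 1 by omega, Nat.add_sub_cancel] at h
    rw [Finset.sum_range_succ, mul_add, ih]
    linear_combination -h

/-- Writing each `β_j` in the telescoped formula as a difference of consecutive partial sums
eliminates the `β_j`. -/
theorem InFamily.sum_logCoeff_rec {φ : DrinfeldModule Fq L} (hφ : φ.InFamily 1)
    (hT : Function.Injective (algebraMap Fq[X] L)) (n : ℕ) :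
    (algebraMap Fq[X] L X ^ Fintype.card Fq ^ (n + 2) - algebraMap Fq[X] L X)
        * ∑ j ∈ Finset.range (n + 3), φ.logCoeff j =
      (algebraMap Fq[X] L X ^ Fintype.card Fq ^ (n + 2) + φ.Δ ^ Fintype.card Fq ^ (n + 1))
        * ∑ j ∈ Finset.range (n + 2), φ.logCoeff j
      - φ.Δ ^ Fintype.card Fq ^ (n + 1) * ∑ j ∈ Finset.range (n + 1), φ.logCoeff j := by
  have h := hφ.mul_sum_logCoeff hT (n + 1)
  rw [Finset.sum_range_succ _ (n + 2), Finset.sum_range_succ _ (n + 1)] at h ⊢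
  linear_combination -h

theorem normalizedPeriodCoeff_eq (hT : Function.Injective (algebraMap Fq[X] L)) (n : ℕ) :
    φ.normalizedPeriodCoeff n =
      (∏ i ∈ Finset.Icc 1 n, (algebraMap Fq[X] L X ^ (Fintype.card Fq ^ i) - algebraMap Fq[X] L X))
        * (algebraMap Fq[X] L X * ∑ j ∈ Finset.range (n + 1), φ.logCoeff j)
        / algebraMap Fq[X] L X ^ (∑ i ∈ Finset.range (n + 1), Fintype.card Fq ^ i) := by
  simp only [normalizedPeriodCoeff, periodCoeff, log_eq_logSeries φ hT, coeff_logSeries, one_pow,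
    mul_one, map_prod, map_sub, map_pow]

theorem InFamily.normalizedPeriodCoeff_rec {φ : DrinfeldModule Fq L} (hφ : φ.InFamily 1)
    (hT : Function.Injective (algebraMap Fq[X] L)) (n : ℕ) :
    φ.normalizedPeriodCoeff (n + 2) =
      (1 - (-φ.Δ / algebraMap Fq[X] L X ^ Fintype.card Fq) ^ Fintype.card Fq ^ (n + 1))
        * φ.normalizedPeriodCoeff (n + 1)
      + (1 - algebraMap Fq[X] L X ^ (1 - (Fintype.card Fq : ℤ) ^ (n + 1)))
        * (-φ.Δ / algebraMap Fq[X] L X ^ Fintype.card Fq) ^ Fintype.card Fq ^ (n + 1)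
        * φ.normalizedPeriodCoeff n := by
  have ht : algebraMap Fq[X] L X ≠ 0 := (map_ne_zero_iff _ hT).2 X_ne_zero
  have h := hφ.sum_logCoeff_rec hT n
  -- The sign comes out of the `q^(n+1)`-th power in every characteristic because Frobenius is a
  -- ring homomorphism.
  have h1 : (-φ.Δ / algebraMap Fq[X] L X ^ Fintype.card Fq) ^ Fintype.card Fq ^ (n + 1) =
      -(φ.Δ ^ Fintype.card Fq ^ (n + 1)) / algebraMap Fq[X] L X ^ Fintype.card Fq ^ (n + 2) := by
    rw [div_pow, ← pow_mul, ← pow_succ', ← frob_pow_apply Fq L, _root_.map_neg,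
      frob_pow_apply]
  have h2 : algebraMap Fq[X] L X ^ (1 - (Fintype.card Fq : ℤ) ^ (n + 1)) =
      algebraMap Fq[X] L X / algebraMap Fq[X] L X ^ Fintype.card Fq ^ (n + 1) := by
    rw [zpow_sub₀ ht, zpow_one, ← zpow_natCast]
    norm_cast
  rw [h1, h2]
  have e0 := φ.normalizedPeriodCoeff_eq hT n
  have e1 := φ.normalizedPeriodCoeff_eq hT (n + 1)
  have e2 := φ.normalizedPeriodCoeff_eq hT (n + 2)
  rw [Finset.prod_Icc_succ_top (by omega),
    Finset.sum_range_succ (fun i => Fintype.card Fq ^ i) (n + 1),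
    pow_add (algebraMap Fq[X] L X)] at e1
  rw [Finset.prod_Icc_succ_top (by omega), Finset.prod_Icc_succ_top (by omega),
    Finset.sum_range_succ (fun i => Fintype.card Fq ^ i) (n + 2),
    Finset.sum_range_succ (fun i => Fintype.card Fq ^ i) (n + 1),
    pow_add (algebraMap Fq[X] L X), pow_add (algebraMap Fq[X] L X)] at e2
  rw [e0, e1, e2]
  clear e0 e1 e2
  change _ * (_ * ∑ j ∈ Finset.range (n + 3), _) / _ =
    _ * (_ * (_ * ∑ j ∈ Finset.range (n + 2), _) / _)
    + _ * (_ * (_ * ∑ j ∈ Finset.range (n + 1), _) / _)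
  change _ * (algebraMap Fq[X] L X ^ Fintype.card Fq ^ (n + 2) - _) * _ / _ = _
  generalize ∏ i ∈ Finset.Icc 1 n,
    (algebraMap Fq[X] L X ^ (Fintype.card Fq ^ i) - algebraMap Fq[X] L X) = P at *
  generalize ∑ j ∈ Finset.range (n + 3), φ.logCoeff j = S2 at *
  generalize ∑ j ∈ Finset.range (n + 2), φ.logCoeff j = S1 at *
  generalize ∑ j ∈ Finset.range (n + 1), φ.logCoeff j = S0 at *
  have ha := pow_ne_zero (Fintype.card Fq ^ (n + 1)) ht
  have hb := pow_ne_zero (Fintype.card Fq ^ (n + 2)) ht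
  have hM := pow_ne_zero (∑ i ∈ Finset.range (n + 1), Fintype.card Fq ^ i) ht
  generalize algebraMap Fq[X] L X ^ Fintype.card Fq ^ (n + 1) = a at *
  generalize algebraMap Fq[X] L X ^ Fintype.card Fq ^ (n + 2) = b at *
  generalize algebraMap Fq[X] L X ^ (∑ i ∈ Finset.range (n + 1), Fintype.card Fq ^ i) = M at *
  field_simp
  -- Here `P = L_n` and `a - T = [n+1]`, so the recursion for partial sums is being multiplied by
  -- `L_{n+1}`.
  linear_combination P * (a - algebraMap Fq[X] L X) * h

theorem InFamily.normalizedPeriodCoeff_one {φ : DrinfeldModule Fq L} (hφ : φ.InFamily 1)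
    (hT : Function.Injective (algebraMap Fq[X] L)) :
    φ.normalizedPeriodCoeff 1 = 1 + φ.Δ / algebraMap Fq[X] L X ^ Fintype.card Fq := by
  have ht : algebraMap Fq[X] L X ≠ 0 := (map_ne_zero_iff _ hT).2 X_ne_zero
  have h := hφ.mul_sum_logCoeff hT 0
  have h' := φ.twistedMul_logCoeff_tauCoeffT hT 1
  rw [twistedMul_tauCoeffT_right, hφ.g_eq] at h'
  rw [normalizedPeriodCoeff_eq φ hT]
  simp only [Finset.sum_range_succ, le_refl, if_true, Nat.sub_self] at h h' ⊢
  norm_num [logCoeff.eq_1] at h h' ⊢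
  rw [pow_add, pow_one]
  have hQ := pow_ne_zero (Fintype.card Fq) ht
  generalize algebraMap Fq[X] L X ^ Fintype.card Fq = Q at *
  field_simp
  linear_combination h'

end DrinfeldModule

/-! ### Bassa–Beelen polynomials: the value at `-Δ/T^q` and the subset formula -/

section BassaBeelen

variable (Fq : Type*) [Field Fq] [Fintype Fq]

theorem bassaBeelen_zero : bassaBeelen Fq 0 = 1 := rfl

theorem bassaBeelen_one : bassaBeelen Fq 1 = X - 1 := by
  simp [bassaBeelen, bassaBeelenAux]

theorem bassaBeelen_add_two (n : ℕ) : bassaBeelen Fq (n + 2) =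
    (X ^ (Fintype.card Fq ^ (n + 1)) - 1) * bassaBeelen Fq (n + 1)
      + C (1 - (RatFunc.X : RatFunc Fq) ^ (1 - (Fintype.card Fq : ℤ) ^ (n + 1)))
        * X ^ (Fintype.card Fq ^ (n + 1)) * bassaBeelen Fq n := rfl

variable {Fq}

theorem DrinfeldModule.InFamily.aeval_bassaBeelen {L : Type*} [Field L]
    [Algebra Fq[X] L] [Algebra (RatFunc Fq) L] [IsScalarTower Fq[X] (RatFunc Fq) L]
    {φ : DrinfeldModule Fq L} (hφ : φ.InFamily 1) (hT : Function.Injective (algebraMap Fq[X] L)) :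
    ∀ n : ℕ, aeval (-φ.Δ / algebraMap Fq[X] L X ^ Fintype.card Fq) (bassaBeelen Fq n)
        = (-1) ^ n * φ.normalizedPeriodCoeff n
  | 0 => by
    have ht : algebraMap Fq[X] L X ≠ 0 := (map_ne_zero_iff _ hT).2 X_ne_zero
    simp [bassaBeelen_zero, normalizedPeriodCoeff_eq φ hT, logCoeff, ht]
  | 1 => by
    rw [bassaBeelen_one, hφ.normalizedPeriodCoeff_one hT]
    simp only [map_sub, aeval_X, map_one]
    ring
  | n + 2 => by
    have hX : algebraMap (RatFunc Fq) L RatFunc.X = algebraMap Fq[X] L X := by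
      rw [IsScalarTower.algebraMap_apply Fq[X] (RatFunc Fq) L, RatFunc.algebraMap_X]
    rw [bassaBeelen_add_two, hφ.normalizedPeriodCoeff_rec hT]
    simp only [_root_.map_add, _root_.map_mul, map_sub, map_pow, aeval_X, map_one, aeval_C,
      map_zpow₀, hX, aeval_bassaBeelen hφ hT (n + 1), aeval_bassaBeelen hφ hT n]
    ring

/-- A new largest element `n+1` either prolongs the block ending at `n` or starts a block of its
own; earlier block starts are unaffected. -/
theorem blockStarts_insert_succ {n : ℕ} {S : Finset ℕ} (hS : S ⊆ Finset.range (n + 1)) :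
    blockStarts (insert (n + 1) S) =
      if n ∈ S then blockStarts S else insert (n + 1) (blockStarts S) := by
  have h : (S.filter fun i => i = 0 ∨ i - 1 ∉ insert (n + 1) S) = blockStarts S := by
    refine Finset.filter_congr fun i hi => ?_
    have := Finset.mem_range.1 (hS hi)
    rw [Finset.mem_insert, or_iff_right (show ¬ i - 1 = n + 1 by omega)]
  rw [blockStarts, Finset.filter_insert, h]
  by_cases hn : n ∈ S <;> simp [hn]

theorem setMonomial_insert_succ {n : ℕ} {S : Finset ℕ} (hS : S ⊆ Finset.range (n + 1)) :
    setMonomial Fq (insert (n + 1) S) =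
      (if n ∈ S then 1 else X ^ (Fintype.card Fq ^ (n + 1) - 1)) * setMonomial Fq S := by
  rw [setMonomial, blockStarts_insert_succ hS, setMonomial]
  split_ifs
  · rw [one_mul]
  · rw [Finset.prod_insert]
    intro h
    have := Finset.mem_range.1 (hS (Finset.mem_filter.1 h).1)
    omega

variable (Fq) in
/-- The term of the explicit formula for the Bassa–Beelen polynomial `p_n` given by `S`. -/
noncomputable def subsetTerm (n : ℕ) (S : Finset ℕ) : (RatFunc Fq)[X] :=
  C ((-1) ^ (n - S.card) / algebraMap Fq[X] (RatFunc Fq) (setMonomial Fq S)) * X ^ setWeight Fq S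

theorem card_le_of_subset_range {n : ℕ} {S : Finset ℕ} (hS : S ⊆ Finset.range n) : S.card ≤ n := by
  simpa using Finset.card_le_card hS

theorem subsetTerm_succ {n : ℕ} {S : Finset ℕ} (hS : S ⊆ Finset.range n) :
    subsetTerm Fq (n + 1) S = -subsetTerm Fq n S := by
  rw [subsetTerm, subsetTerm, Nat.succ_sub (card_le_of_subset_range hS), pow_succ, mul_neg_one,
    neg_div, C_neg, neg_mul]

theorem subsetTerm_insert {n : ℕ} {S : Finset ℕ} (hS : S ⊆ Finset.range (n + 1)) :
    subsetTerm Fq (n + 2) (insert (n + 1) S) =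
      C (if n ∈ S then 1 else (RatFunc.X : RatFunc Fq) ^ (1 - (Fintype.card Fq : ℤ) ^ (n + 1)))
        * X ^ (Fintype.card Fq ^ (n + 1)) * subsetTerm Fq (n + 1) S := by
  have hn : n + 1 ∉ S := fun h => by simpa using hS h
  have hq : 1 ≤ Fintype.card Fq ^ (n + 1) := Nat.one_le_pow _ _ Fintype.card_pos
  have hw : setWeight Fq (insert (n + 1) S) = Fintype.card Fq ^ (n + 1) + setWeight Fq S :=
    Finset.sum_insert hn
  have hX : (RatFunc.X : RatFunc Fq) ^ (1 - (Fintype.card Fq : ℤ) ^ (n + 1)) =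
      (RatFunc.X ^ (Fintype.card Fq ^ (n + 1) - 1))⁻¹ := by
    rw [← zpow_natCast, ← zpow_neg]
    push_cast [hq]
    congr 1
    ring
  rw [subsetTerm, subsetTerm, Finset.card_insert_of_notMem hn, setMonomial_insert_succ hS, hw, hX,
    show n + 2 - (S.card + 1) = n + 1 - S.card by omega,
    pow_add (X : (RatFunc Fq)[X]), _root_.map_mul, div_mul_eq_div_div,
    show C (((-1) ^ (n + 1 - S.card) / algebraMap Fq[X] (RatFunc Fq)
      (if n ∈ S then 1 else X ^ (Fintype.card Fq ^ (n + 1) - 1))) /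
        algebraMap Fq[X] (RatFunc Fq) (setMonomial Fq S)) =
      C (if n ∈ S then (1 : RatFunc Fq) else (RatFunc.X ^ (Fintype.card Fq ^ (n + 1) - 1))⁻¹) *
      C ((-1) ^ (n + 1 - S.card) / algebraMap Fq[X] (RatFunc Fq) (setMonomial Fq S)) by
        rw [← C_mul]
        split_ifs
        · rw [map_one, div_one, one_mul]
        · rw [map_pow, RatFunc.algebraMap_X]
          congr 1
          ring]
  ring

theorem bassaBeelen_eq_sum : ∀ n : ℕ, bassaBeelen Fq n =
    ∑ S ∈ (Finset.range n).powerset, subsetTerm Fq n S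
  | 0 => by simp [bassaBeelen_zero, subsetTerm, setMonomial, blockStarts, setWeight]
  | 1 => by
    simp [bassaBeelen_one, subsetTerm, setMonomial, blockStarts, setWeight,
      
      show ({0} : Finset ℕ).powerset = {∅, {0}} from rfl, Finset.filter_singleton]
    ring
  | n + 2 => by
    have hsplit : ∀ (m : ℕ) (f : Finset ℕ → (RatFunc Fq)[X]),
        ∑ S ∈ (Finset.range (m + 1)).powerset, f S = ∑ S ∈ (Finset.range m).powerset, f S
          + ∑ S ∈ (Finset.range m).powerset, f (insert m S) := fun m f => by
      rw [Finset.range_add_one, Finset.sum_powerset_insert Finset.notMem_range_self]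
    -- Passing from `n` to `n+1` with `S` fixed changes only the sign `(-1)^(n - |S|)`.
    have h0 : ∑ S ∈ (Finset.range n).powerset, subsetTerm Fq (n + 1) S = -bassaBeelen Fq n := by
      rw [bassaBeelen_eq_sum n, ← Finset.sum_neg_distrib]
      exact Finset.sum_congr rfl fun S hS => subsetTerm_succ (Finset.mem_powerset.1 hS)
    have h1 : ∑ S ∈ (Finset.range (n + 1)).powerset, subsetTerm Fq (n + 2) S =
        -bassaBeelen Fq (n + 1) := by
      rw [bassaBeelen_eq_sum (n + 1), ← Finset.sum_neg_distrib]
      exact Finset.sum_congr rfl fun S hS => subsetTerm_succ (Finset.mem_powerset.1 hS)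
    -- The subsets of `{0, …, n}` containing `n` therefore contribute `p_{n+1} + p_n`, and those
    -- avoiding `n` contribute `-p_n`. After insertion of `n+1`, only the latter pick up the factor
    -- `T^(1 - q^(n+1))`.
    have h2 : bassaBeelen Fq (n + 1) = -bassaBeelen Fq n +
        ∑ S ∈ (Finset.range n).powerset, subsetTerm Fq (n + 1) (insert n S) := by
      rw [bassaBeelen_eq_sum (n + 1), hsplit, h0]
    rw [hsplit, h1, Finset.sum_congr rfl fun S hS => subsetTerm_insert (Finset.mem_powerset.1 hS),
      hsplit, Finset.sum_congr rfl fun S hS => by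
        rw [if_neg fun h => Finset.notMem_range_self (Finset.mem_powerset.1 hS h)],
      ← Finset.mul_sum, h0]
    simp only [Finset.mem_insert_self, if_true]
    rw [← Finset.mul_sum, bassaBeelen_add_two, C_sub, C_1]
    linear_combination X ^ Fintype.card Fq ^ (n + 1) * h2

end BassaBeelen

/-- A power of `T` is a unit at a prime `P ∤ T`, so denominators of this form may be cleared. -/
theorem isZeroMod_iff {Fq : Type*} [Field Fq] {P : Fq[X]} (hP : Irreducible P) (hX : ¬ P ∣ X)
    {x : RatFunc Fq} {N : ℕ} {u : Fq[X]} (hu : x * RatFunc.X ^ N = algebraMap Fq[X] (RatFunc Fq) u) :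
    IsZeroMod P x ↔ P ∣ u := by
  constructor
  · rintro ⟨a, b, hb, h⟩
    have : u * b = P * a * X ^ N := by
      apply RatFunc.algebraMap_injective Fq
      rw [map_mul, ← hu, map_mul, ← h, map_pow, RatFunc.algebraMap_X]
      ring
    exact (hP.prime.dvd_or_dvd (this ▸ (Dvd.intro _ rfl).mul_right _)).resolve_right hb
  · rintro ⟨c, rfl⟩
    refine ⟨c, X ^ N, fun h => hX (hP.prime.dvd_of_dvd_pow h), ?_⟩
    rw [map_pow, RatFunc.algebraMap_X, hu]

/-! ### Numerators in `𝔽_q[T]` and their divisibility by `P` -/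

section Frobenius

variable {Fq : Type*} [Field Fq] [Fintype Fq]

theorem dvd_X_pow_card_pow_sub_X_iff {P : Fq[X]} (hP : Irreducible P) (n : ℕ) :
    P ∣ X ^ Fintype.card Fq ^ n - X ↔ P.natDegree ∣ n := by
  rw [hP.natDegree_dvd_iff_dvd_X_pow_card_pow_sub_X, Nat.card_eq_fintype_card]

/-- The polynomial `T^(q^n) - T` is separable, hence squarefree. -/
theorem not_mul_self_dvd_X_pow_card_pow_sub_X {P : Fq[X]} (hP : Irreducible P) {n : ℕ}
    (hn : n ≠ 0) : ¬ P * P ∣ X ^ Fintype.card Fq ^ n - X := by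
  obtain ⟨p, hp⟩ := CharP.exists Fq
  obtain ⟨r, hpp, hr⟩ := FiniteField.card Fq p
  have hs : (X ^ Fintype.card Fq ^ n - X : Fq[X]).Separable :=
    galois_poly_separable p _ (hr ▸ dvd_pow (dvd_pow_self p r.ne_zero) hn)
  exact fun h => hP.not_isUnit (hs.squarefree P h)

/-- The numerator `r_n` of the `n`-th coefficient `β_n = r_n / ∏_{i ≤ n} (T - T^(q^i))` of the
logarithm of the Drinfeld module with `φ_T = T - (T + Δ)τ + Δτ²`. -/
noncomputable def logNumerator (Δ : Fq[X]) : ℕ → Fq[X]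
  | 0 => 1
  | 1 => -(X + Δ)
  | n + 2 => -(X ^ Fintype.card Fq ^ (n + 1) + Δ ^ Fintype.card Fq ^ (n + 1))
        * logNumerator Δ (n + 1)
      - (X ^ Fintype.card Fq ^ (n + 1) - X) * Δ ^ Fintype.card Fq ^ n * logNumerator Δ n

/-- The numerator `T^(q + ⋯ + q^n) p_n(-Δ/T^q)` of the value of the Bassa–Beelen polynomial. -/
noncomputable def bassaBeelenNumerator (Δ : Fq[X]) : ℕ → Fq[X]
  | 0 => 1
  | 1 => -(X ^ Fintype.card Fq ^ 1 + Δ)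
  | n + 2 => -(X ^ Fintype.card Fq ^ (n + 2) + Δ ^ Fintype.card Fq ^ (n + 1))
        * bassaBeelenNumerator Δ (n + 1)
      - (X ^ Fintype.card Fq ^ (n + 1) - X) * Δ ^ Fintype.card Fq ^ (n + 1)
        * bassaBeelenNumerator Δ n

/-- This is the telescoped formula `mul_sum_logCoeff` multiplied by `∏ (T - T^(q^i))` over `1 ≤ i ≤
n+1`, proved directly in `𝔽_q[T]` from the two recursions. -/
theorem X_mul_bassaBeelenNumerator (Δ : Fq[X]) : ∀ n, X * bassaBeelenNumerator Δ (n + 1) =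
    logNumerator Δ (n + 1) * X ^ Fintype.card Fq ^ (n + 1)
      + (X ^ Fintype.card Fq ^ (n + 1) - X) * Δ ^ Fintype.card Fq ^ n * logNumerator Δ n
  | 0 => by
    simp only [bassaBeelenNumerator, logNumerator, zero_add, pow_zero]
    ring
  | 1 => by
    have h := X_mul_bassaBeelenNumerator Δ 0
    simp only [bassaBeelenNumerator, logNumerator, zero_add, pow_zero, pow_one, Nat.reduceAdd] at h ⊢
    linear_combination -(X ^ Fintype.card Fq ^ 2 + Δ ^ Fintype.card Fq) * h
  | n + 2 => by
    have h := X_mul_bassaBeelenNumerator Δ (n + 1)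
    have h' := X_mul_bassaBeelenNumerator Δ n
    have hr : logNumerator Δ (n + 2) = _ := logNumerator.eq_3 Δ n
    rw [bassaBeelenNumerator.eq_3, logNumerator.eq_3]
    simp only [show n + 1 + 1 = n + 2 from rfl, show n + 1 + 2 = n + 3 from rfl] at h ⊢
    linear_combination -(X ^ Fintype.card Fq ^ (n + 3) + Δ ^ Fintype.card Fq ^ (n + 2)) * h
      - (X ^ Fintype.card Fq ^ (n + 2) - X) * Δ ^ Fintype.card Fq ^ (n + 2) * h'
      - (X ^ Fintype.card Fq ^ (n + 2) - X) * Δ ^ Fintype.card Fq ^ (n + 2) * hr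

theorem eval_bassaBeelen_mul_pow (Δ : Fq[X]) : ∀ n, (bassaBeelen Fq n).eval
      (-algebraMap Fq[X] (RatFunc Fq) Δ / RatFunc.X ^ Fintype.card Fq)
        * RatFunc.X ^ (∑ i ∈ Finset.range n, Fintype.card Fq ^ (i + 1)) =
      algebraMap Fq[X] (RatFunc Fq) (bassaBeelenNumerator Δ n)
  | 0 => by simp [bassaBeelen_zero, bassaBeelenNumerator]
  | 1 => by
    have hX := pow_ne_zero (Fintype.card Fq) (RatFunc.X_ne_zero (K := Fq))
    simp only [bassaBeelen_one, bassaBeelenNumerator, Finset.sum_range_succ, Finset.range_zero,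
      Finset.sum_empty, zero_add, pow_one, eval_sub, eval_X, eval_one, map_neg, map_add, map_pow,
      RatFunc.algebraMap_X]
    field_simp
    ring
  | n + 2 => by
    have hX := RatFunc.X_ne_zero (K := Fq)
    have h := eval_bassaBeelen_mul_pow Δ (n + 1)
    have h' := eval_bassaBeelen_mul_pow Δ n
    have h1 : (-algebraMap Fq[X] (RatFunc Fq) Δ / RatFunc.X ^ Fintype.card Fq)
        ^ Fintype.card Fq ^ (n + 1) =
        -(algebraMap Fq[X] (RatFunc Fq) Δ ^ Fintype.card Fq ^ (n + 1))
          / RatFunc.X ^ Fintype.card Fq ^ (n + 2) := by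
      rw [div_pow, ← pow_mul, ← pow_succ', ← DrinfeldModule.frob_pow_apply Fq (RatFunc Fq),
        _root_.map_neg, DrinfeldModule.frob_pow_apply]
    have h2 : (RatFunc.X : RatFunc Fq) ^ (1 - (Fintype.card Fq : ℤ) ^ (n + 1)) =
        RatFunc.X / RatFunc.X ^ Fintype.card Fq ^ (n + 1) := by
      rw [zpow_sub₀ hX, zpow_one, ← zpow_natCast]
      norm_cast
    rw [Finset.sum_range_succ, pow_add (RatFunc.X : RatFunc Fq)] at h
    rw [bassaBeelen_add_two, bassaBeelenNumerator, Finset.sum_range_succ, Finset.sum_range_succ,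
      pow_add (RatFunc.X : RatFunc Fq), pow_add (RatFunc.X : RatFunc Fq)]
    simp only [eval_add, eval_mul, eval_sub, eval_pow, eval_X, eval_one, eval_C, h1, h2,
      map_neg, map_sub, map_mul, map_add, map_pow, RatFunc.algebraMap_X, ← h, ← h',
      show n + 1 + 1 = n + 2 from rfl]
    have ha := pow_ne_zero (Fintype.card Fq ^ (n + 1)) hX
    have hb := pow_ne_zero (Fintype.card Fq ^ (n + 2)) hX
    generalize (RatFunc.X : RatFunc Fq) ^ Fintype.card Fq ^ (n + 1) = a at *
    generalize (RatFunc.X : RatFunc Fq) ^ Fintype.card Fq ^ (n + 2) = b at *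
    field_simp
    ring

theorem isZeroMod_eval_bassaBeelen_iff {P : Fq[X]} (hP : Irreducible P) (hX : ¬ P ∣ X)
    (Δ : Fq[X]) : IsZeroMod P ((bassaBeelen Fq P.natDegree).eval
      (-algebraMap Fq[X] (RatFunc Fq) Δ / RatFunc.X ^ Fintype.card Fq)) ↔
      P ∣ logNumerator Δ P.natDegree := by
  rw [isZeroMod_iff hP hX (eval_bassaBeelen_mul_pow Δ P.natDegree)]
  have hd := (dvd_X_pow_card_pow_sub_X_iff hP P.natDegree).2 dvd_rfl
  obtain ⟨m, hm⟩ := Nat.exists_eq_succ_of_ne_zero hP.natDegree_pos.ne'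
  rw [hm, Nat.succ_eq_add_one] at hd ⊢
  have h := X_mul_bassaBeelenNumerator Δ m
  -- With `m + 1 = deg P`, the prime `P` divides `T^(q^(m+1)) - T`, which kills the second term.
  have h1 : P ∣ X * bassaBeelenNumerator Δ (m + 1) ↔
      P ∣ logNumerator Δ (m + 1) * X ^ Fintype.card Fq ^ (m + 1) := by
    rw [h]
    exact (dvd_add_left ((hd.mul_right _).mul_right _))
  constructor
  · intro h2
    exact (hP.prime.dvd_or_dvd (h1.1 (h2.mul_left _))).resolve_right
      fun h => hX (hP.prime.dvd_of_dvd_pow h)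
  · intro h2
    exact (hP.prime.dvd_or_dvd (h1.2 (h2.mul_right _))).resolve_left hX

/-- Modulo `Δ` the recursion loses its second term, and `r_n` becomes a power of `T` up to sign.
Thus `P ∣ r_n` with `P ∤ T` already forces good reduction. -/
theorem not_dvd_logNumerator {P : Fq[X]} (hP : Irreducible P) (hX : ¬ P ∣ X) {Δ : Fq[X]}
    (hΔ : P ∣ Δ) : ∀ n, ¬ P ∣ logNumerator Δ n
  | 0 => hP.not_dvd_one
  | 1 => by
    rw [logNumerator, dvd_neg, dvd_add_left hΔ]
    exact hX
  | n + 2 => by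
    have hk : ∀ k, P ∣ Δ ^ Fintype.card Fq ^ k := fun k =>
      dvd_pow hΔ (pow_ne_zero _ Fintype.card_ne_zero)
    rw [logNumerator, dvd_sub_left (((hk n).mul_left _).mul_right _), neg_mul, dvd_neg, add_mul,
      dvd_add_left ((hk _).mul_right _)]
    intro h
    rcases hP.prime.dvd_or_dvd h with h | h
    · exact hX (hP.prime.dvd_of_dvd_pow h)
    · exact not_dvd_logNumerator hP hX hΔ (n + 1) h

end Frobenius

/-! ### Denominators of the logarithm and the degree of `φ_a` -/

namespace DrinfeldModule

variable {Fq : Type*} [Field Fq] [Fintype Fq] {L : Type*} [Field L] [Algebra Fq[X] L]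
  (φ : DrinfeldModule Fq L)

theorem InFamily.algebraMap_logNumerator {φ : DrinfeldModule Fq L} (hφ : φ.InFamily 1)
    (hT : Function.Injective (algebraMap Fq[X] L)) {Δ : Fq[X]}
    (hΔ : φ.Δ = algebraMap Fq[X] L Δ) : ∀ n, algebraMap Fq[X] L (logNumerator Δ n) =
      algebraMap Fq[X] L (∏ i ∈ Finset.Ioc 0 n, (X - X ^ Fintype.card Fq ^ i)) * φ.logCoeff n
  | 0 => by simp [logNumerator, logCoeff]
  | 1 => by
    have := sub_pow_ne_zero hT 1 one_ne_zero
    simp only [logNumerator, logCoeff, hφ.g_eq, hΔ, Nat.Ioc_succ_singleton, zero_add,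
      Finset.prod_singleton, _root_.map_neg, _root_.map_add, map_sub, map_pow]
    field_simp
  | n + 2 => by
    have := sub_pow_ne_zero hT (n + 2) (by omega)
    have h1 := algebraMap_logNumerator hφ hT hΔ (n + 1)
    have h0 := algebraMap_logNumerator hφ hT hΔ n
    rw [logNumerator, logCoeff, hφ.g_eq, neg_add_pow_card_pow, hΔ]
    rw [Finset.prod_Ioc_succ_top (by omega), _root_.map_mul] at h1
    rw [Finset.prod_Ioc_succ_top (by omega), Finset.prod_Ioc_succ_top (by omega)]
    simp only [_root_.map_neg, _root_.map_add, map_sub, map_pow, _root_.map_mul,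
      h1, h0] at h1 ⊢
    simp only [show n + 1 + 1 = n + 2 from rfl]
    field_simp
    ring

theorem natDegree_toFun_X : (φ.toFun X).natDegree = Fintype.card Fq ^ 2 := by
  have hq : 1 < Fintype.card Fq := Fintype.one_lt_card
  have hq2 : Fintype.card Fq < Fintype.card Fq ^ 2 := by nlinarith
  rw [φ.map_T, natDegree_add_eq_right_of_natDegree_lt, natDegree_C_mul_X_pow _ _ φ.Δ_ne_zero]
  rw [natDegree_C_mul_X_pow _ _ φ.Δ_ne_zero]
  refine (natDegree_add_le _ _).trans_lt (max_lt ?_ ?_)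
  · exact (natDegree_C_mul_le _ _).trans_lt (by rw [natDegree_X]; omega)
  · exact (natDegree_C_mul_X_pow_le _ _).trans_lt hq2

theorem natDegree_toFun (a : Fq[X]) (ha : a ≠ 0) :
    (φ.toFun a).natDegree = Fintype.card Fq ^ (2 * a.natDegree) := by
  have hq : 1 < Fintype.card Fq := Fintype.one_lt_card
  generalize hd : a.natDegree = d
  induction d generalizing a with
  | zero =>
    obtain ⟨c, rfl⟩ := natDegree_eq_zero.1 hd
    have hc : algebraMap Fq[X] L (C c) ≠ 0 := by
      have : Function.Injective ((algebraMap Fq[X] L).comp (C : Fq →+* Fq[X])) :=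
        RingHom.injective _
      exact (map_ne_zero_iff _ this).2 fun h => ha (by rw [h, C_0])
    rw [φ.map_const, natDegree_C_mul hc, natDegree_X, mul_zero, pow_zero]
  | succ d ih =>
    have h := divX_mul_X_add a
    have h1 : a.divX.natDegree = d := by rw [natDegree_divX_eq_natDegree_tsub_one, hd]; rfl
    have h2 : a.divX ≠ 0 := by
      rintro h0
      rw [h0, zero_mul, zero_add] at h
      rw [← h, natDegree_C] at hd
      omega
    have h3 : ((φ.toFun a.divX).comp (φ.toFun X)).natDegree = Fintype.card Fq ^ (2 * (d + 1)) := by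
      rw [natDegree_comp, ih _ h2 h1, natDegree_toFun_X, ← pow_add]
      rfl
    rw [← h, φ.map_add, φ.map_mul, φ.map_const, natDegree_add_eq_left_of_natDegree_lt, h3]
    rw [h3]
    exact ((natDegree_C_mul_le _ _).trans_eq natDegree_X).trans_lt (Nat.one_lt_pow (by omega) hq)

/-! ### Reduction modulo `P` and supersingularity -/

section residue

variable {P : Fq[X]} [hP : Fact (Irreducible P)]
  (ψ : DrinfeldModule Fq (Fq[X] ⧸ Ideal.span {P}))

theorem tauCoeff_self_zero : ψ.tauCoeff P 0 = 0 := by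
  rw [tauCoeff_zero]
  exact Ideal.Quotient.eq_zero_iff_mem.2 (Ideal.mem_span_singleton_self P)

/-- If all lower coefficients vanish, comparing coefficients of `τ^i` in `ψ_P ψ_T = ψ_T ψ_P` gives
`(T^(q^i) - T) c_i = 0`, and `T^(q^i) - T` is nonzero in `𝔽_q[T]/(P)` unless `deg P ∣ i`. -/
theorem tauCoeff_self_eq_zero_of_forall_lt {i : ℕ} (h : ∀ j < i, ψ.tauCoeff P j = 0)
    (hi : ¬ P.natDegree ∣ i) : ψ.tauCoeff P i = 0 := by
  have hi0 : i ≠ 0 := fun h => hi (h ▸ dvd_zero _)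
  have h1 := congrFun (ψ.tauCoeff_mul_X P) i
  rw [mul_comm, tauCoeff_X_mul, twistedMul_tauCoeffT_left, twistedMul_tauCoeffT_right,
    h (i - 1) (by omega), h (i - 2) (by omega)] at h1
  simp only [zero_pow (pow_ne_zero _ (Fintype.card_ne_zero (α := Fq))), zero_mul, ite_self,
    mul_zero, add_zero] at h1
  have h2 : (algebraMap Fq[X] (Fq[X] ⧸ Ideal.span {P}) X ^ Fintype.card Fq ^ i
      - algebraMap Fq[X] (Fq[X] ⧸ Ideal.span {P}) X) * ψ.tauCoeff P i = 0 := by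
    linear_combination -h1
  refine (mul_eq_zero.1 h2).resolve_left fun h3 => hi ?_
  rw [← map_pow, ← map_sub] at h3
  exact (dvd_X_pow_card_pow_sub_X_iff hP.out i).1
    (Ideal.mem_span_singleton.1 (Ideal.Quotient.eq_zero_iff_mem.1 h3))

theorem tauCoeff_self_eq_zero_of_lt (i : ℕ) (hi : i < P.natDegree) : ψ.tauCoeff P i = 0 := by
  induction i using Nat.strong_induction_on with
  | _ i ih =>
    rcases Nat.eq_zero_or_pos i with rfl | h0
    · exact ψ.tauCoeff_self_zero
    · exact ψ.tauCoeff_self_eq_zero_of_forall_lt (fun j hj => ih j hj (hj.trans hi))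
        (Nat.not_dvd_of_pos_of_lt h0 hi)

theorem tauCoeff_self_eq_zero_of_lt_two_mul (h : ψ.tauCoeff P P.natDegree = 0) (i : ℕ)
    (hi : i < 2 * P.natDegree) : ψ.tauCoeff P i = 0 := by
  induction i using Nat.strong_induction_on with
  | _ i ih =>
    by_cases hd : P.natDegree ∣ i
    · obtain ⟨k, rfl⟩ := hd
      have hk : k < 2 := Nat.lt_of_mul_lt_mul_left (hi.trans_eq (mul_comm _ _))
      interval_cases k
      · exact ψ.tauCoeff_self_zero
      · rwa [mul_one]
    · exact ψ.tauCoeff_self_eq_zero_of_forall_lt (fun j hj => ih j hj (hj.trans hi)) hd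

/-- Let `d = deg P`. As a polynomial in `z`, `ψ_P = z^(q^d) f(z)`, where `f(0)` is the coefficient
of `τ^d`. If it is nonzero, `f` is nonconstant and its roots are nonzero torsion points; if it is
zero, `ψ_P` is a monomial of degree `q^(2d)`. -/
theorem torsion_self_eq_zero_iff : ψ.torsion P = {0} ↔ ψ.tauCoeff P P.natDegree = 0 := by
  have hq : 1 < Fintype.card Fq := Fintype.one_lt_card
  have hn := hP.out.natDegree_pos
  have hdeg := ψ.natDegree_toFun P hP.out.ne_zero
  constructor
  · intro h
    by_contra hc
    obtain ⟨f, hf⟩ : X ^ Fintype.card Fq ^ P.natDegree ∣ ψ.toFun P := by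
      rw [X_pow_dvd_iff]
      intro d hd
      by_cases h' : ∃ i, d = Fintype.card Fq ^ i
      · obtain ⟨i, rfl⟩ := h'
        exact ψ.tauCoeff_self_eq_zero_of_lt i ((Nat.pow_lt_pow_iff_right hq).1 hd)
      · push Not at h'
        exact ψ.toFun_coeff_eq_zero P d h'
    have hf0 : f.coeff 0 ≠ 0 := by
      intro h0
      apply hc
      have := coeff_X_pow_mul f (Fintype.card Fq ^ P.natDegree) 0
      rwa [zero_add, ← hf, h0] at this
    have hf' : f ≠ 0 := by rintro rfl; exact hf0 (coeff_zero 0)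
    have hfd : f.degree ≠ 0 := by
      intro hd
      have hd' : f.natDegree = 0 := natDegree_eq_of_degree_eq_some hd
      rw [hf, natDegree_X_pow_mul _ hf', hd', zero_add] at hdeg
      have := Nat.pow_right_injective hq hdeg
      omega
    obtain ⟨y, hy⟩ := IsAlgClosed.exists_aeval_eq_zero
      (AlgebraicClosure (Fq[X] ⧸ Ideal.span {P})) f hfd
    have hy0 : y ∈ ψ.torsion P := by
      change aeval y (ψ.toFun P) = 0
      rw [hf, _root_.map_mul, hy, mul_zero]
    rw [h, Set.mem_singleton_iff] at hy0
    rw [hy0, ← coeff_zero_eq_aeval_zero', map_eq_zero_iff _ (RingHom.injective _)] at hy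
    exact hf0 hy
  · intro h
    have hlc : (ψ.toFun P).coeff (Fintype.card Fq ^ (2 * P.natDegree)) ≠ 0 := by
      rw [← hdeg, coeff_natDegree, leadingCoeff_ne_zero]
      rintro h0
      rw [h0, natDegree_zero] at hdeg
      exact pow_ne_zero _ Fintype.card_ne_zero hdeg.symm
    have hf : ψ.toFun P = C ((ψ.toFun P).coeff (Fintype.card Fq ^ (2 * P.natDegree)))
        * X ^ Fintype.card Fq ^ (2 * P.natDegree) := by
      ext m
      rw [coeff_C_mul, coeff_X_pow]
      split_ifs with hm
      · rw [hm, mul_one]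
      · rw [mul_zero]
        by_cases h' : ∃ i, m = Fintype.card Fq ^ i
        · obtain ⟨i, rfl⟩ := h'
          rcases lt_trichotomy i (2 * P.natDegree) with hi | rfl | hi
          · exact ψ.tauCoeff_self_eq_zero_of_lt_two_mul h i hi
          · exact absurd rfl hm
          · exact coeff_eq_zero_of_natDegree_lt (hdeg ▸ Nat.pow_lt_pow_right hq hi)
        · push Not at h'
          exact ψ.toFun_coeff_eq_zero P m h'
    ext x
    change aeval x (ψ.toFun P) = 0 ↔ x = 0
    rw [hf, _root_.map_mul, aeval_C, map_pow, aeval_X, mul_eq_zero,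
      map_eq_zero_iff _ (RingHom.injective _), or_iff_right hlc,
      pow_eq_zero_iff (pow_ne_zero _ Fintype.card_ne_zero)]

theorem IsReductionAt.exists_lift {φ : DrinfeldModule Fq L}
    {ψ : DrinfeldModule Fq (Fq[X] ⧸ Ideal.span {P})} (h : φ.IsReductionAt P ψ) (a : Fq[X]) :
    ∃ l : ℕ → Fq[X], (∀ i, algebraMap Fq[X] L (l i) = φ.tauCoeff a i) ∧
      ∀ i, Ideal.Quotient.mk (Ideal.span {P}) (l i) = ψ.tauCoeff a i := by
  obtain ⟨f, h1, h2⟩ := h a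
  refine ⟨fun i => f.coeff (Fintype.card Fq ^ i), fun i => ?_, fun i => ?_⟩
  · rw [tauCoeff, ← h1, coeff_map]
  · rw [tauCoeff, ← h2, coeff_map]

/-- Reducing `key` modulo `P²` leaves `P r_d ≡ D l_d` with `D = ∏ (T - T^(q^j))` over `1 ≤ j ≤ d =
deg P`. As `P` divides `D` exactly once, `r_d` and `l_d` differ by a unit modulo `P`. -/
theorem IsReductionAt.tauCoeff_natDegree_eq_zero_iff {φ : DrinfeldModule Fq L}
    {ψ : DrinfeldModule Fq (Fq[X] ⧸ Ideal.span {P})} (h : φ.IsReductionAt P ψ)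
    (hφ : φ.InFamily 1) (hT : Function.Injective (algebraMap Fq[X] L)) {Δ : Fq[X]}
    (hΔ : φ.Δ = algebraMap Fq[X] L Δ) :
    ψ.tauCoeff P P.natDegree = 0 ↔ P ∣ logNumerator Δ P.natDegree := by
  have hPr := hP.out.prime
  obtain ⟨l, hl, hl'⟩ := h.exists_lift P
  have hdvd : ∀ i, P ∣ l i ↔ ψ.tauCoeff P i = 0 := fun i => by
    rw [← hl', Ideal.Quotient.eq_zero_iff_mem, Ideal.mem_span_singleton]
  rw [← hdvd]
  have hl0 : l 0 = P := hT (by rw [hl, tauCoeff_zero])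
  have hlt : ∀ i < P.natDegree, P ∣ l i := fun i hi =>
    (hdvd i).2 (ψ.tauCoeff_self_eq_zero_of_lt i hi)
  have key : ∑ i ∈ Finset.range (P.natDegree + 1),
      (∏ j ∈ Finset.Ioc i P.natDegree, (X - X ^ Fintype.card Fq ^ j)) * logNumerator Δ i
        * l (P.natDegree - i) ^ Fintype.card Fq ^ i = P * logNumerator Δ P.natDegree := by
    apply hT
    have h1 := φ.twistedMul_tauCoeff_eq φ.logCoeff (φ.twistedMul_logCoeff_tauCoeffT hT)
      P P.natDegree
    rw [twistedMul_eq_sum_range] at h1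
    rw [_root_.map_mul, hφ.algebraMap_logNumerator hT hΔ, mul_left_comm, ← h1, map_sum,
      Finset.mul_sum]
    refine Finset.sum_congr rfl fun i hi => ?_
    rw [Finset.mem_range] at hi
    -- The product over `0 < j ≤ d` splits at `i`: the first part clears the denominator of `β_i`,
    -- the second stays as a cofactor.
    rw [frob_pow_apply, _root_.map_mul, _root_.map_mul, hφ.algebraMap_logNumerator hT hΔ, map_pow,
      hl, ← Finset.prod_Ioc_consecutive _ (Nat.zero_le i) (show i ≤ P.natDegree by omega),
      _root_.map_mul]
    ring
  have hPX := (dvd_X_pow_card_pow_sub_X_iff hP.out P.natDegree).2 dvd_rfl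
  have hPX2 := not_mul_self_dvd_X_pow_card_pow_sub_X hP.out hP.out.natDegree_pos.ne'
  have hPXlt : ∀ j, 0 < j → j < P.natDegree → ¬ P ∣ X - X ^ Fintype.card Fq ^ j :=
    fun j hj hj' h => by
      rw [dvd_sub_comm, dvd_X_pow_card_pow_sub_X_iff hP.out] at h
      exact Nat.not_dvd_of_pos_of_lt hj hj' h
  obtain ⟨m, hm⟩ := Nat.exists_eq_succ_of_ne_zero hP.out.natDegree_pos.ne'
  rw [hm, Nat.succ_eq_add_one] at key hPX hPX2 hlt hPXlt ⊢
  obtain ⟨u, hu⟩ := hPX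
  have hPu : ¬ P ∣ u := fun h => hPX2 (hu ▸ mul_dvd_mul_left P h)
  have hprod : ¬ P ∣ ∏ j ∈ Finset.Ioc 0 m, (X - X ^ Fintype.card Fq ^ j) := by
    rw [hPr.dvd_finsetProd_iff]
    rintro ⟨j, hj, h⟩
    rw [Finset.mem_Ioc] at hj
    exact hPXlt j hj.1 (by omega) h
  rw [Finset.sum_range_succ, Finset.sum_range_succ', Finset.Ioc_self, Finset.prod_empty, one_mul,
    Nat.sub_self, hl0, Nat.sub_zero, pow_zero, pow_one, Finset.prod_Ioc_succ_top (Nat.zero_le m),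
    show (X - X ^ Fintype.card Fq ^ (m + 1) : Fq[X]) = P * -u by linear_combination -hu] at key
  -- In the terms with `0 < i < d` one factor `P` comes from `T - T^(q^d)` in the cofactor and
  -- another from the coefficient `l_{d-i}`, whose index is positive and below `d`.
  have hmid : P * P ∣ ∑ i ∈ Finset.range m,
      (∏ j ∈ Finset.Ioc (i + 1) (m + 1), (X - X ^ Fintype.card Fq ^ j)) * logNumerator Δ (i + 1)
        * l (m + 1 - (i + 1)) ^ Fintype.card Fq ^ (i + 1) := by
    refine Finset.dvd_sum fun i hi => mul_dvd_mul (Dvd.dvd.mul_right ?_ _) ?_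
    · rw [Finset.mem_range] at hi
      refine dvd_trans ?_ (Finset.dvd_prod_of_mem _ (Finset.mem_Ioc.2 ⟨by omega, le_refl (m + 1)⟩))
      rw [dvd_sub_comm, hu]
      exact Dvd.intro _ rfl
    · exact dvd_pow (hlt _ (by omega)) (pow_ne_zero _ Fintype.card_ne_zero)
  have hlast : P * P ∣ logNumerator Δ (m + 1) * P ^ Fintype.card Fq ^ (m + 1) := by
    rw [← sq]
    exact (pow_dvd_pow P (Nat.one_lt_pow (by omega) Fintype.one_lt_card)).mul_left _
  have hfin : P * P ∣ P * (logNumerator Δ (m + 1)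
      + (∏ j ∈ Finset.Ioc 0 m, (X - X ^ Fintype.card Fq ^ j)) * u * l (m + 1)) := by
    convert! dvd_add hmid hlast using 1
    rw [logNumerator.eq_1] at key
    linear_combination -key
  rw [mul_dvd_mul_iff_left hP.out.ne_zero] at hfin
  constructor
  · intro h
    exact (dvd_add_left (h.mul_left _)).1 hfin
  · intro h
    have := (dvd_add_right h).1 hfin
    exact (hPr.dvd_or_dvd this).resolve_left fun h => (hPr.dvd_or_dvd h).elim hprod hPu

theorem IsReductionAt.eval_one {φ : DrinfeldModule Fq L}
    {ψ : DrinfeldModule Fq (Fq[X] ⧸ Ideal.span {P})} (h : φ.IsReductionAt P ψ)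
    (hT : Function.Injective (algebraMap Fq[X] L)) (hφ : φ.InFamily 1) :
    (ψ.toFun X).eval 1 = 0 := by
  obtain ⟨f, h1, h2⟩ := h X
  have h3 := hφ 1
  rw [C_1, map_one, one_mul, ← h1, eval_one_map, map_eq_zero_iff _ hT] at h3
  rw [← h2, eval_one_map, h3, map_zero]

theorem exists_lift_toFun {φ : DrinfeldModule Fq L} (hφ : φ.InFamily 1) {Δ : Fq[X]}
    (hΔ : φ.Δ = algebraMap Fq[X] L Δ) (a : Fq[X]) :
    ∃ f : Fq[X][X], f.map (algebraMap Fq[X] L) = φ.toFun a := by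
  refine Polynomial.induction_X_mul ?_ ?_ ?_ a
  · exact fun c => ⟨C (C c) * X, by rw [φ.map_const, Polynomial.map_mul, map_C, map_X]⟩
  · rintro a b ⟨f, hf⟩ ⟨g, hg⟩
    exact ⟨f + g, by rw [φ.map_add, Polynomial.map_add, hf, hg]⟩
  · rintro a ⟨f, hf⟩
    refine ⟨C X * f + C (-(X + Δ)) * f ^ Fintype.card Fq ^ 1 + C Δ * f ^ Fintype.card Fq ^ 2, ?_⟩
    rw [toFun_X_mul, hφ.g_eq, hΔ, ← hf]
    simp

theorem exists_isReductionAt {φ : DrinfeldModule Fq L} (hφ : φ.InFamily 1)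
    (hT : Function.Injective (algebraMap Fq[X] L)) {Δ : Fq[X]}
    (hΔ : φ.Δ = algebraMap Fq[X] L Δ) (hPΔ : ¬ P ∣ Δ) :
    ∃ ψ : DrinfeldModule Fq (Fq[X] ⧸ Ideal.span {P}), φ.IsReductionAt P ψ := by
  -- The lifts are chosen separately for each `a`; injectivity of `𝔽_q[T][X] → L[X]` makes them
  -- satisfy the laws of a Drinfeld module before reduction.
  choose F hF using exists_lift_toFun hφ hΔ
  have hinj := Polynomial.map_injective _ hT
  refine ⟨⟨fun a => (F a).map (Ideal.Quotient.mk (Ideal.span {P})),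
    Ideal.Quotient.mk (Ideal.span {P}) (-(X + Δ)), Ideal.Quotient.mk (Ideal.span {P}) Δ,
    ?_, fun a b => ?_, fun a b => ?_, fun c => ?_, ?_⟩, fun a => ⟨F a, hF a, rfl⟩⟩
  · rwa [Ne, Ideal.Quotient.eq_zero_iff_mem, Ideal.mem_span_singleton]
  · rw [← Polynomial.map_add]
    congr 1
    exact hinj (by simp only [Polynomial.map_add, hF, φ.map_add])
  · rw [← Polynomial.map_comp]
    congr 1
    exact hinj (by simp only [Polynomial.map_comp, hF, φ.map_mul])
  · have : F (C c) = C (C c) * X :=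
      hinj (by rw [hF, φ.map_const, Polynomial.map_mul, map_C, map_X])
    rw [this, Polynomial.map_mul, map_C, map_X]
    rfl
  · have : F X = C X * X + C (-(X + Δ)) * X ^ Fintype.card Fq + C Δ * X ^ Fintype.card Fq ^ 2 :=
      hinj (by rw [hF, φ.map_T, hφ.g_eq, hΔ]; simp)
    rw [this]
    simp only [Polynomial.map_add, Polynomial.map_mul, map_C, map_X, Polynomial.map_pow]
    rfl

theorem isSupersingularAt_iff_dvd {φ : DrinfeldModule Fq L} (hφ : φ.InFamily 1)
    (hT : Function.Injective (algebraMap Fq[X] L)) {Δ : Fq[X]}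
    (hΔ : φ.Δ = algebraMap Fq[X] L Δ) (hX : ¬ P ∣ X) :
    φ.IsSupersingularAt P ↔ P ∣ logNumerator Δ P.natDegree := by
  constructor
  · rintro ⟨ψ, hψ, ht⟩
    exact (hψ.tauCoeff_natDegree_eq_zero_iff hφ hT hΔ).1 (ψ.torsion_self_eq_zero_iff.1 ht)
  · intro h
    obtain ⟨ψ, hψ⟩ := exists_isReductionAt hφ hT hΔ
      fun hPΔ => not_dvd_logNumerator hP.out hX hPΔ _ h
    exact ⟨ψ, hψ, ψ.torsion_self_eq_zero_iff.2
      ((hψ.tauCoeff_natDegree_eq_zero_iff hφ hT hΔ).2 h)⟩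

/-- Here `P` is `T` up to a unit, and `1 ∈ ker φ_T` survives reduction as a nonzero `P`-torsion
point. -/
theorem not_isSupersingularAt_of_dvd_X {φ : DrinfeldModule Fq L} (hφ : φ.InFamily 1)
    (hT : Function.Injective (algebraMap Fq[X] L)) (hX : P ∣ X) : ¬ φ.IsSupersingularAt P := by
  rintro ⟨ψ, hψ, ht⟩
  obtain ⟨s, hs⟩ := (hP.out.associated_of_dvd irreducible_X hX).symm.dvd
  have h1 : (1 : AlgebraicClosure (Fq[X] ⧸ Ideal.span {P})) ∈ ψ.torsion P := by
    have h0 : (ψ.toFun s).coeff 0 = 0 :=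
      ψ.toFun_coeff_eq_zero s 0 fun i => (pow_ne_zero i Fintype.card_ne_zero).symm
    have h2 : ψ.toFun P = (ψ.toFun s).comp (ψ.toFun X) := by
      rw [← ψ.map_mul, mul_comm, ← hs]
    change aeval 1 (ψ.toFun P) = 0
    rw [h2, ← map_one (algebraMap (Fq[X] ⧸ Ideal.span {P}) _), aeval_algebraMap_apply,
      coe_aeval_eq_eval,
      eval_comp, hψ.eval_one hT hφ, ← coeff_zero_eq_eval_zero, h0, map_zero]
  rw [ht] at h1
  exact one_ne_zero h1

end residue

end DrinfeldModule

/-- In this case `deg P = 1`, and `p_1(-Δ/T^q) = -(T^q + Δ)/T^q` has numerator congruent to `-Δ`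
modulo `P`, hence prime to `P`. The denominator `T^q` can only lower the valuation. -/
theorem not_isZeroMod_eval_bassaBeelen_of_dvd_X {Fq : Type*} [Field Fq] [Fintype Fq] {P : Fq[X]}
    (hP : Irreducible P) (hX : P ∣ X) {Δ : Fq[X]} (hΔ : ¬ P ∣ Δ) :
    ¬ IsZeroMod P ((bassaBeelen Fq P.natDegree).eval
      (-algebraMap Fq[X] (RatFunc Fq) Δ / RatFunc.X ^ Fintype.card Fq)) := by
  have h1 : P.natDegree = 1 := Nat.dvd_one.1
    ((dvd_X_pow_card_pow_sub_X_iff hP 1).1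
      (dvd_sub (dvd_pow hX (pow_ne_zero _ Fintype.card_ne_zero)) hX))
  rw [h1]
  rintro ⟨a, b, hb, h⟩
  have h2 := eval_bassaBeelen_mul_pow Δ 1
  have h3 : bassaBeelenNumerator Δ 1 * b = P * (a * X ^ Fintype.card Fq) := by
    apply RatFunc.algebraMap_injective Fq
    rw [map_mul, ← h2, ← mul_assoc, map_mul, ← h, map_pow, RatFunc.algebraMap_X]
    simp
    ring
  have h4 := (hP.prime.dvd_or_dvd (Dvd.intro _ h3.symm)).resolve_right hb
  rw [bassaBeelenNumerator, dvd_neg, dvd_add_right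
    (dvd_pow hX (pow_ne_zero _ Fintype.card_ne_zero))] at h4
  exact hΔ h4

theorem mainTheorem2 {Fq : Type*} [Field Fq] [Fintype Fq] {L : Type*} [Field L]
    [Algebra Fq[X] L] [Algebra (RatFunc Fq) L] [IsScalarTower Fq[X] (RatFunc Fq) L]
    (φ : DrinfeldModule Fq L) (hφ : φ.InFamily 1)
    (Δ : Fq[X]) (hΔ : φ.Δ = algebraMap Fq[X] L Δ) :
    (∀ n : ℕ, aeval (-φ.Δ / algebraMap Fq[X] L X ^ Fintype.card Fq) (bassaBeelen Fq n)
        = (-1) ^ n * φ.normalizedPeriodCoeff n) ∧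
    (∀ n : ℕ, bassaBeelen Fq n = ∑ S ∈ (Finset.range n).powerset,
        C ((-1) ^ (n - S.card) / algebraMap Fq[X] (RatFunc Fq) (setMonomial Fq S))
          * X ^ setWeight Fq S) ∧
    (∀ (n : ℕ) (P : Fq[X]) [Fact (Irreducible P)], P.natDegree = n → ¬ (P ∣ X ∧ P ∣ Δ) →
      (φ.IsSupersingularAt P ↔
        IsZeroMod P ((bassaBeelen Fq n).eval
          (-algebraMap Fq[X] (RatFunc Fq) Δ / RatFunc.X ^ Fintype.card Fq)))) := by
  have hT : Function.Injective (algebraMap Fq[X] L) := by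
    rw [IsScalarTower.algebraMap_eq Fq[X] (RatFunc Fq) L, RingHom.coe_comp]
    exact (RingHom.injective _).comp (RatFunc.algebraMap_injective Fq)
  refine ⟨hφ.aeval_bassaBeelen hT, bassaBeelen_eq_sum, ?_⟩
  rintro n P hP rfl hPT
  by_cases hX : P ∣ X
  · exact iff_of_false (DrinfeldModule.not_isSupersingularAt_of_dvd_X hφ hT hX)
      (not_isZeroMod_eval_bassaBeelen_of_dvd_X hP.out hX fun h => hPT ⟨hX, h⟩)
  · rw [isZeroMod_eval_bassaBeelen_iff hP.out hX]
    exact DrinfeldModule.isSupersingularAt_iff_dvd hφ hT hΔ hX
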